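/- A set $W$ is *computably enumerable* in the usual sense of computability theory. A polynomial $q(y_1,\dots,y_\nu;n,\bar m)$ with integer coefficients, in the unknowns $\bar y$ and the parameters $n$ and $\bar m=(m_1,\dots,m_\mu)$, is *positively universal* if for every computably enumerable $W\subseteq\mathbb N$ there is $\bar m\in\mathbb N^\mu$ such that $q(\bar y;n,\bar m)\ge 0$ for all $\bar y\in\mathbb N^\nu$, $n\in\mathbb N$, and such that for every $n \in \mathbb N$: $n\in W$ if and only if $q(\bar y;n,\bar m)=0$ for some $\bar y\in\mathbb N^\nu$. Here $0 \in \mathbb N$. A subset of $\mathbb R^a\times(\mathbb N^{\mathbb N})^b$ is *semicomputable* if it is the union of a computably enumerable family of basic open boxes (products of open intervals with rational endpoints and of sets of all sequences extending a given finite sequence). A set $A\subseteq Y=\mathbb R^a\times(\mathbb N^{\mathbb N})^b$ is (lightface) $\Sigma^1_1$ if it is the projection to $Y$ of the complement of a semicomputable subset of $Y\times\mathbb N^{\mathbb N}$; it is $\Sigma^1_{n+1}$ if it is the projection to $Y$ of a $\Pi^1_n$ subset of $Y\times\mathbb N^{\mathbb N}$, where $\Pi^1_n$ sets are the complements of $\Sigma^1_n$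 sets. **Theorem.** Suppose there is a positively universal polynomial $q(\bar y;n,\bar m)$ with $\nu$ unknowns and of degree at most $\delta$, where the degree is taken jointly in $\bar y$ and $n$ (in particular, this holds if $q$ has total degree $\delta$). Let $a\ge 0$, $m\geq 1$ and let $X\subseteq\mathbb R^a$ be a (lightface) $\Sigma^1_m$ set. Put $K=6+\nu+2a+2m$. Then there is a polynomial $p(x_1,\dots,x_a,z_1,\dots,z_m,n,k_1,\dots,k_K)$ with integer coefficients, of total degree exactly $\max\{3+\delta,7\}$, such that the following holds, with all suprema and infima computed in $[-\infty,\infty]$. If $m$ is odd, then $$f(\bar x)=\sup_{z_1\in\mathbb R}\inf_{z_2\in\mathbb R}\cdots\inf_{z_{m-1}\in\mathbb R}\sup_{z_m\in\mathbb R}\ \inf_{n\in\mathbb N}\ \sup_{\bar k\in\mathbb N^{K}}p(\bar x,\bar z,n,\bar k)$$ is the indicator function of $X$ (value $1$ on $X$ and $0$ off $X$), and if $m$ is even, then $$f(\bar x)=\sup_{z_1\in\mathbb R}\inf_{z_2\in\mathbb R}\cdots\sup_{z_{m-1}\in\mathbb R}\inf_{z_m\in\mathbb R}\ \sup_{n\in\mathbb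 N}\ \inf_{\bar k\in\mathbb N^{K}}p(\bar x,\bar z,n,\bar k)$$ is the indicator function of $X$. -/

import Mathlib

namespace LightfaceProjective

/-- The product space `ℝ^a × (ℕ^ℕ)^b`. -/
abbrev Space (a b : ℕ) : Type := (Fin a → ℝ) × (Fin b → ℕ → ℕ)

/-- The rational open interval with code `(i, j, k, l)`, namely
`((j - k) / (1 + i), (j - k + l + 1) / (1 + i))`.  Every nonempty bounded open interval with rational
endpoints is of this form. -/
def realNbhd (c : ℕ × ℕ × ℕ × ℕ) : Set ℝ :=
  Set.Ioo (((c.2.1 : ℝ) - c.2.2.1) / (1 + c.1))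
    (((c.2.1 : ℝ) - c.2.2.1 + c.2.2.2 + 1) / (1 + c.1))

/-- The basic open subset of Baire space `ℕ^ℕ` of all sequences that start with the finite
sequence `s`. -/
def baireNbhd (s : List ℕ) : Set (ℕ → ℕ) :=
  {α | ∀ (i : ℕ) (h : i < s.length), α i = s[i]}

/-- Codes (finite data) of basic open subsets of `ℝ^a × (ℕ^ℕ)^b`. -/
abbrev Code (a b : ℕ) : Type := (Fin a → ℕ × ℕ × ℕ × ℕ) × (Fin b → List ℕ)

/-- The basic open box with a given code: a product of rational open intervals and of basic open
subsets of Baire space. -/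
def basicNbhd {a b : ℕ} (c : Code a b) : Set (Space a b) :=
  {p | (∀ i, p.1 i ∈ realNbhd (c.1 i)) ∧ ∀ j, p.2 j ∈ baireNbhd (c.2 j)}

/-- `U` is semicomputable (lightface `Σ⁰₁`): it is the union of a computably enumerable family of
basic open sets. -/
def Semicomputable {a b : ℕ} (U : Set (Space a b)) : Prop :=
  ∃ W : Set (Code a b), REPred (fun c => c ∈ W) ∧ U = ⋃ c ∈ W, basicNbhd c

/-- The projection `(ℝ^a × (ℕ^ℕ)^b) × ℕ^ℕ → ℝ^a × (ℕ^ℕ)^b` along the last factor. -/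
def proj {a b : ℕ} (p : Space a (b + 1)) : Space a b := (p.1, Fin.init p.2)

/-- `IsSigma m A`: the set `A ⊆ ℝ^a × (ℕ^ℕ)^b` is lightface `Σ¹ₘ`.
A `Σ¹₁` set is the projection along `ℕ^ℕ` of the complement of a semicomputable set, and a
`Σ¹ₙ₊₁` set is the projection along `ℕ^ℕ` of a `Π¹ₙ` set, that is, of a set whose complement
is `Σ¹ₙ`.  The hierarchy starts at level `1`; there are no `Σ¹₀` sets. -/
def IsSigma {a : ℕ} : ℕ → {b : ℕ} → Set (Space a b) → Prop
  | 0, _, _ => False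
  | 1, b, A => ∃ U : Set (Space a (b + 1)), Semicomputable U ∧ A = proj '' Uᶜ
  | n + 2, b, A => ∃ B : Set (Space a (b + 1)), IsSigma (n + 1) Bᶜ ∧ A = proj '' B

/-- `X ⊆ ℝ^a` is lightface `Σ¹ₘ` (identifying `ℝ^a` with `ℝ^a × (ℕ^ℕ)^0`). -/
def IsLightfaceSigma {a : ℕ} (m : ℕ) (X : Set (Fin a → ℝ)) : Prop :=
  IsSigma m (Prod.fst ⁻¹' X : Set (Space a 0))

/-- The value of `q(y; n, m)`, where `q` has the unknowns `y₁, …, y_ν`, the parameter `n`, and the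
tuple of parameters `m₁, …, m_μ`. -/
noncomputable def evalParam {ν μ : ℕ} (q : MvPolynomial (Fin ν ⊕ Unit ⊕ Fin μ) ℤ)
    (y : Fin ν → ℕ) (n : ℕ) (m : Fin μ → ℕ) : ℤ :=
  MvPolynomial.eval
    (Sum.elim (fun i => (y i : ℤ)) (Sum.elim (fun _ => (n : ℤ)) (fun j => (m j : ℤ)))) q

/-- `q(y; n, m)` is positively universal: for every computably enumerable `W ⊆ ℕ` there is `m` such
that `q(·; ·, m)` is nonnegative on natural numbers and `n ∈ W` iff `q(·; n, m)` has a zero in the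
natural numbers. -/
def PositivelyUniversal {ν μ : ℕ} (q : MvPolynomial (Fin ν ⊕ Unit ⊕ Fin μ) ℤ) : Prop :=
  ∀ W : Set ℕ, REPred (fun n => n ∈ W) →
    ∃ m : Fin μ → ℕ,
      (∀ (y : Fin ν → ℕ) (n : ℕ), 0 ≤ evalParam q y n m) ∧
      ∀ n : ℕ, n ∈ W ↔ ∃ y : Fin ν → ℕ, evalParam q y n m = 0

/-- The degree of `q(y; n, m)` jointly in the unknowns `y` and in `n`, the parameters `m` being
treated as part of the coefficients.  It is at most the total degree of `q`. -/
noncomputable def degreeUnknowns {ν μ : ℕ} (q : MvPolynomial (Fin ν ⊕ Unit ⊕ Fin μ) ℤ) : ℕ :=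
  q.weightedTotalDegree (Sum.elim (fun _ => 1) (Sum.elim (fun _ => 1) (fun _ => 0)))

/-- Alternating suprema and infima over `m` real variables, in the extended reals:
`altExtr true m F = sup_{z₁} inf_{z₂} sup_{z₃} ⋯ F (z₁, …, z_m)`, and `altExtr false m F` is the
same with an infimum first. -/
noncomputable def altExtr : Bool → (m : ℕ) → ((Fin m → ℝ) → EReal) → EReal
  | _, 0, F => F Fin.elim0
  | true, m + 1, F => ⨆ z : ℝ, altExtr false m (fun w => F (Fin.cons z w))
  | false, m + 1, F => ⨅ z : ℝ, altExtr true m (fun w => F (Fin.cons z w))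

/-- The real number `p(x, z, n, k)`, as an extended real, for an integer polynomial `p`. -/
noncomputable def evalPoly {a m K : ℕ} (p : MvPolynomial (Fin a ⊕ Fin m ⊕ Unit ⊕ Fin K) ℤ)
    (x : Fin a → ℝ) (z : Fin m → ℝ) (n : ℕ) (k : Fin K → ℕ) : EReal :=
  ((MvPolynomial.aeval
    (Sum.elim x (Sum.elim z (Sum.elim (fun _ => (n : ℝ)) (fun i => (k i : ℝ))))) p : ℝ) : EReal)

end LightfaceProjective

open LightfaceProjective

/-! Unfolding the hierarchy writes `X` as an alternating block of `m` quantifiers over sequences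
with a semicomputable matrix `U`, which ends up negated exactly when `m` is odd
(`IsLightfaceSigma.exists_altEx`). Sequences are replaced by real variables through `digits (z ^
2)`, a surjection from ℝ under which every cylinder is, in `z ^ 2`, a half-open interval with
computable endpoints (`digits_mem_baireNbhd`, `surjective_digits_sq`).

Each box of `U` thus becomes a union of closed boxes with natural-number coefficients, so the
complement of `U` is an intersection of open sets `OpenAt f n` (`notMem_iff_forall_openAt`).
Membership in the `n`-th open set is certified by a simultaneous rational approximation: a common
denominator `d`, a shift `h` and numerators `s i` with `d * (v i + h)` close to `s i`, satisfying
the decidable condition `Good`. A certificate with errors below 1 is sound (`Good.openAt`), and by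
Dirichlet approximation a point of the open set has certificates with arbitrarily small errors
(`OpenAt.exists_good`).

The pair of `n` and the certificate is packed into one number, and `q` expresses that this number is
good. The penalty is `q`, plus squares forcing the packing, plus the squared errors. The first two
are nonnegative integers, so a penalty below 1 makes them vanish and yields a valid certificate.
With a natural number `u`, the expression `u * (2 - u - penalty)` never exceeds 1, is 0 at `u = 0`,
equals `1 - penalty` at `u = 1`, and is at most 0 once the penalty is at least 1. Its supremum is
therefore the truth value of `OpenAt` (`iSup_mainPoly`). Subtracting `u * t ^ r` only fixes the
degree. The remaining suprema and infima act as quantifiers on truth values (`altExtr_truth`). -/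

namespace LightfaceProjective

/-! ### Alternating quantifiers and the normal form of lightface sets -/

/-- `AltEx m P` says `∃ z₁, ¬ ∃ z₂, ¬ ⋯ ∃ z_m, ¬ P (z₁, …, z_m)`. -/
def AltEx {β : Type*} : (m : ℕ) → ((Fin m → β) → Prop) → Prop
  | 0, P => P Fin.elim0
  | m + 1, P => ∃ z : β, ¬ AltEx m (fun w => P (Fin.cons z w))

theorem altEx_congr {β : Type*} {m : ℕ} {P Q : (Fin m → β) → Prop} (h : ∀ w, P w ↔ Q w) :
    AltEx m P ↔ AltEx m Q := by
  rw [funext fun w => propext (h w)]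

/-- Alternating quantifiers may be pulled back along a surjection. -/
theorem altEx_comp_surjective {β γ : Type*} {ρ : β → γ} (hρ : Function.Surjective ρ) :
    ∀ {m : ℕ} (P : (Fin m → γ) → Prop),
      AltEx m (fun w : Fin m → β => P (fun i => ρ (w i))) ↔ AltEx m P
  | 0, P => by
    simp only [AltEx]
    rw [show (fun i : Fin 0 => ρ (Fin.elim0 i)) = Fin.elim0 from funext fun i => i.elim0]
  | m + 1, P => by
    simp only [AltEx]
    rw [hρ.exists]
    refine exists_congr fun z => not_congr ?_
    rw [← altEx_comp_surjective hρ (fun w => P (Fin.cons (ρ z) w))]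
    refine altEx_congr fun w => ?_
    rw [show (fun i => ρ ((Fin.cons z w : Fin (m + 1) → β) i)) =
      (Fin.cons (ρ z) fun i => ρ (w i) : Fin (m + 1) → γ) from
      funext fun i => by refine Fin.cases ?_ (fun i => ?_) i <;> simp]

/-- The concatenation of two tuples, with a free index type for the result. -/
def glue {β : Type*} {b m c : ℕ} (hc : c = b + m) (u : Fin b → β) (w : Fin m → β) : Fin c → β :=
  fun i => Fin.append u w (Fin.cast hc i)

theorem glue_snoc {β : Type*} {b m c : ℕ} (h : c = b + 1 + m) (h' : c = b + (m + 1))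
    (u : Fin b → β) (z : β) (w : Fin m → β) :
    glue h (Fin.snoc u z : Fin (b + 1) → β) w = glue h' u (Fin.cons z w : Fin (m + 1) → β) := by
  funext i
  unfold glue
  rcases lt_trichotomy (i : ℕ) b with hi | hi | hi
  · have e1 : Fin.cast h i = Fin.castAdd m (Fin.castSucc ⟨i, hi⟩) := rfl
    have e2 : Fin.cast h' i = Fin.castAdd (m + 1) ⟨i, hi⟩ := rfl
    rw [e1, e2, Fin.append_left, Fin.append_left, Fin.snoc_castSucc]
  · have e1 : Fin.cast h i = Fin.castAdd m (Fin.last b) := Fin.ext (by simpa using hi)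
    have e2 : Fin.cast h' i = Fin.natAdd b 0 := Fin.ext (by simpa using hi)
    rw [e1, e2, Fin.append_left, Fin.append_right, Fin.snoc_last, Fin.cons_zero]
  · have hlt : (i : ℕ) - (b + 1) < m := by omega
    have e1 : Fin.cast h i = Fin.natAdd (b + 1) ⟨i - (b + 1), hlt⟩ :=
      Fin.ext (by simp; omega)
    have e2 : Fin.cast h' i = Fin.natAdd b (Fin.succ ⟨i - (b + 1), hlt⟩) :=
      Fin.ext (by simp; omega)
    rw [e1, e2, Fin.append_right, Fin.append_right, Fin.cons_succ]

theorem mem_image_proj {a b : ℕ} {B : Set (Space a (b + 1))} {x : Fin a → ℝ}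
    {u : Fin b → ℕ → ℕ} :
    (x, u) ∈ proj '' B ↔ ∃ z : ℕ → ℕ, (x, (Fin.snoc u z : Fin (b + 1) → ℕ → ℕ)) ∈ B := by
  constructor
  · rintro ⟨⟨x', v⟩, hv, h⟩
    simp only [proj, Prod.mk.injEq] at h
    obtain ⟨rfl, rfl⟩ := h
    exact ⟨v (Fin.last b), by rwa [Fin.snoc_init_self]⟩
  · rintro ⟨z, hz⟩
    exact ⟨_, hz, by simp [proj]⟩

/-- The normal form of a `Σ¹ₘ` set. -/
theorem IsSigma.exists_altEx {a : ℕ} : ∀ (m : ℕ) {b c : ℕ} (hc : c = b + m)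
    {A : Set (Space a b)}, IsSigma m A →
      ∃ U : Set (Space a c), Semicomputable U ∧
        ∀ x u, (x, u) ∈ A ↔ AltEx m (fun w => (x, glue hc u w) ∈ U)
  | 0, _, _, _, _, h => by simp [IsSigma] at h
  | 1, b, c, hc, A, h => by
    subst hc
    obtain ⟨U, hU, rfl⟩ := h
    refine ⟨U, hU, fun x u => ?_⟩
    rw [mem_image_proj]
    refine exists_congr fun z => not_congr ?_
    simp only [AltEx]
    rw [← glue_snoc (m := 0) rfl]
    have : glue (m := 0) rfl (Fin.snoc u z : Fin (b + 1) → ℕ → ℕ) Fin.elim0 = Fin.snoc u z := by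
      funext i
      exact Fin.append_left _ _ i
    rw [this]
  | m + 2, b, c, hc, A, h => by
    obtain ⟨B, hB, rfl⟩ := h
    have hc' : c = b + 1 + (m + 1) := by omega
    obtain ⟨U, hU, hUB⟩ := IsSigma.exists_altEx (m + 1) hc' hB
    refine ⟨U, hU, fun x u => ?_⟩
    rw [mem_image_proj, AltEx]
    refine exists_congr fun z => ?_
    rw [← not_iff_not, not_not, ← Set.mem_compl_iff, hUB]
    exact altEx_congr fun w => by rw [glue_snoc hc' hc]

theorem IsLightfaceSigma.exists_altEx {a m : ℕ} {X : Set (Fin a → ℝ)}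
    (h : IsLightfaceSigma m X) :
    ∃ U : Set (Space a m), Semicomputable U ∧ ∀ x, x ∈ X ↔ AltEx m (fun w => (x, w) ∈ U) := by
  obtain ⟨U, hU, hX⟩ := IsSigma.exists_altEx m (Nat.zero_add m).symm h
  refine ⟨U, hU, fun x => ?_⟩
  have := hX x Fin.elim0
  rw [Set.mem_preimage] at this
  rw [this]
  refine altEx_congr fun w => ?_
  have hw : glue (Nat.zero_add m).symm (Fin.elim0 : Fin 0 → ℕ → ℕ) w = w := by
    funext i
    have e : Fin.cast (Nat.zero_add m).symm i = Fin.natAdd 0 i := Fin.ext (by simp)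
    rw [glue, e, Fin.append_right]
  rw [hw]

/-! ### Truth values in the extended reals -/

open Classical in
/-- The truth value of a proposition as an extended real. -/
noncomputable def truth (P : Prop) : EReal := if P then 1 else 0

theorem truth_of {P : Prop} (h : P) : truth P = 1 := if_pos h

theorem truth_of_not {P : Prop} (h : ¬ P) : truth P = 0 := if_neg h

theorem truth_le_one (P : Prop) : truth P ≤ 1 := by
  unfold truth; split_ifs <;> simp

theorem truth_nonneg (P : Prop) : 0 ≤ truth P := by
  unfold truth; split_ifs <;> simp

theorem iSup_truth {ι : Type*} [Nonempty ι] (P : ι → Prop) :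
    ⨆ i, truth (P i) = truth (∃ i, P i) := by
  by_cases h : ∃ i, P i
  · obtain ⟨i, hi⟩ := h
    rw [truth_of ⟨i, hi⟩]
    exact le_antisymm (iSup_le fun _ => truth_le_one _)
      (le_iSup_of_le i (truth_of hi).ge)
  · rw [truth_of_not h]
    push Not at h
    simp [truth_of_not (h _)]

theorem iInf_truth {ι : Type*} [Nonempty ι] (P : ι → Prop) :
    ⨅ i, truth (P i) = truth (∀ i, P i) := by
  by_cases h : ∀ i, P i
  · simp [truth_of h, truth_of (h _)]
  · rw [truth_of_not h]
    push Not at h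
    obtain ⟨i, hi⟩ := h
    exact le_antisymm (iInf_le_of_le i (truth_of_not hi).le) (le_iInf fun _ => truth_nonneg _)

/-- Moving the negations of `AltEx` inwards turns them into alternating ∃ and ∀, and the matrix is
left negated or not according to the parity of `m`. The two halves are proved together because
peeling off one variable exchanges them. -/
theorem altExtr_truth : ∀ (m : ℕ) (P : (Fin m → ℝ) → Prop),
    altExtr true m (fun z => truth (Odd m ↔ ¬ P z)) = truth (AltEx m P) ∧
    altExtr false m (fun z => truth (Odd m ↔ P z)) = truth (¬ AltEx m P)
  | 0, P => by simp [altExtr, AltEx]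
  | m + 1, P => by
    have ih := fun z : ℝ => altExtr_truth m (fun w => P (Fin.cons z w))
    constructor
    · simp only [altExtr, AltEx]
      rw [← iSup_truth]
      refine iSup_congr fun z => ?_
      rw [← (ih z).2]
      congr 1
      funext w
      rw [Nat.odd_add_one, not_iff_not]
    · simp only [altExtr, AltEx]
      push Not
      rw [← iInf_truth]
      refine iInf_congr fun z => ?_
      rw [← (ih z).1]
      congr 1
      funext w
      rw [Nat.odd_add_one]
      exact congrArg truth (propext (by tauto))

/-! ### Coding sequences by nonnegative reals -/

/-- The shift `f / (1 - f)`, with `f` the fractional part, on the reals in `[0, ∞)`. -/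
noncomputable def shift (w : ℝ) : ℝ := Int.fract w / (1 - Int.fract w)

theorem shift_nonneg (w : ℝ) : 0 ≤ shift w :=
  div_nonneg (Int.fract_nonneg w) (by linarith [Int.fract_lt_one w])

/-- The sequence coded by a nonnegative real number. -/
noncomputable def digits (w : ℝ) (i : ℕ) : ℕ := ⌊shift^[i] w⌋₊

/-- One step of the computation of an endpoint of a cylinder; `(p, q)` stands for `p / q`. -/
def endStep (k : ℕ) (e : ℕ × ℕ) : ℕ × ℕ := (k * (e.1 + e.2) + e.1, e.1 + e.2)

/-- The left endpoint of the cylinder of the reals whose sequence extends `s`. -/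
def leftEnd (s : List ℕ) : ℕ × ℕ := s.foldr endStep (0, 1)

/-- The right endpoint of the cylinder of the reals whose sequence extends `s`. -/
def rightEnd (s : List ℕ) : ℕ × ℕ := s.foldr endStep (1, 0)

theorem leftEnd_pos (s : List ℕ) : 0 < (leftEnd s).2 := by
  induction s with
  | nil => simp [leftEnd]
  | cons k s ih => simp only [leftEnd, List.foldr_cons, endStep] at ih ⊢; omega

theorem rightEnd_pos (s : List ℕ) : 0 < (rightEnd s).1 := by
  induction s with
  | nil => simp [rightEnd]
  | cons k s ih => simp only [rightEnd, List.foldr_cons, endStep] at ih ⊢; omega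

/-- The half-open cylinder with code `s`. -/
def Cyl (s : List ℕ) (w : ℝ) : Prop :=
  ((leftEnd s).1 : ℝ) ≤ (leftEnd s).2 * w ∧ ((rightEnd s).2 : ℝ) * w < (rightEnd s).1

/-- The closed cylinder with code `s`. -/
def ClosedCyl (s : List ℕ) (w : ℝ) : Prop :=
  ((leftEnd s).1 : ℝ) ≤ (leftEnd s).2 * w ∧ ((rightEnd s).2 : ℝ) * w ≤ (rightEnd s).1

theorem mem_baireNbhd_cons {k : ℕ} {s : List ℕ} {α : ℕ → ℕ} :
    α ∈ baireNbhd (k :: s) ↔ α 0 = k ∧ (fun i => α (i + 1)) ∈ baireNbhd s := by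
  simp only [baireNbhd, Set.mem_ofPred_eq, List.length_cons]
  constructor
  · intro h
    exact ⟨by simpa using h 0 (by omega), fun i hi => h (i + 1) (Nat.succ_lt_succ hi)⟩
  · rintro ⟨h0, h⟩ i hi
    cases i with
    | zero => simpa using h0
    | succ i => simpa using h i (by omega)

/-- The map `v ↦ k + v / (1 + v)` is increasing, inverts `shift` on `[k, k + 1)`, and sends `p / q`
to the fraction computed by `endStep`. Clearing the positive factor `1 - f` makes both sides the
same linear inequality. -/
theorem leftEnd_cons_le {k : ℕ} {s : List ℕ} {w : ℝ} (h0 : 0 ≤ w) (hk : ⌊w⌋₊ = k) :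
    ((leftEnd (k :: s)).1 : ℝ) ≤ (leftEnd (k :: s)).2 * w ↔
      ((leftEnd s).1 : ℝ) ≤ (leftEnd s).2 * shift w := by
  have hw : w = k + Int.fract w := by
    rw [← hk, natCast_floor_eq_intCast_floor h0, Int.floor_add_fract]
  have h1 : 0 < 1 - Int.fract w := by linarith [Int.fract_lt_one w]
  rw [shift, ← mul_div_assoc, le_div_iff₀ h1]
  generalize Int.fract w = f at *
  subst hw
  simp only [leftEnd, List.foldr_cons, endStep]
  push_cast
  constructor <;> intro h <;> linarith

theorem lt_rightEnd_cons {k : ℕ} {s : List ℕ} {w : ℝ} (h0 : 0 ≤ w) (hk : ⌊w⌋₊ = k) :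
    ((rightEnd (k :: s)).2 : ℝ) * w < (rightEnd (k :: s)).1 ↔
      ((rightEnd s).2 : ℝ) * shift w < (rightEnd s).1 := by
  have hw : w = k + Int.fract w := by
    rw [← hk, natCast_floor_eq_intCast_floor h0, Int.floor_add_fract]
  have h1 : 0 < 1 - Int.fract w := by linarith [Int.fract_lt_one w]
  rw [shift, ← mul_div_assoc, div_lt_iff₀ h1]
  generalize Int.fract w = f at *
  subst hw
  simp only [rightEnd, List.foldr_cons, endStep]
  push_cast
  constructor <;> intro h <;> linarith

theorem le_rightEnd_cons {k : ℕ} {s : List ℕ} {w : ℝ} (h0 : 0 ≤ w) (hk : ⌊w⌋₊ = k) :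
    ((rightEnd (k :: s)).2 : ℝ) * w ≤ (rightEnd (k :: s)).1 ↔
      ((rightEnd s).2 : ℝ) * shift w ≤ (rightEnd s).1 := by
  have hw : w = k + Int.fract w := by
    rw [← hk, natCast_floor_eq_intCast_floor h0, Int.floor_add_fract]
  have h1 : 0 < 1 - Int.fract w := by linarith [Int.fract_lt_one w]
  rw [shift, ← mul_div_assoc, div_le_iff₀ h1]
  generalize Int.fract w = f at *
  subst hw
  simp only [rightEnd, List.foldr_cons, endStep]
  push_cast
  constructor <;> intro h <;> linarith

/-- The left endpoint has the form `k + p / (p + q)`, so it already gives `k ≤ w`. The bound `w < k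
+ 1` is a separate hypothesis because half-open and closed cylinders obtain it for different
reasons. -/
theorem floor_eq_of_ends {k : ℕ} {s : List ℕ} {w : ℝ}
    (hl : ((leftEnd (k :: s)).1 : ℝ) ≤ (leftEnd (k :: s)).2 * w) (hlt : w < k + 1) :
    0 ≤ w ∧ ⌊w⌋₊ = k := by
  have hk : (k : ℝ) ≤ w := by
    have hp : (0 : ℝ) < (leftEnd s).1 + (leftEnd s).2 := by
      have : (0 : ℝ) < (leftEnd s).2 := by exact_mod_cast leftEnd_pos s
      positivity
    refine le_of_mul_le_mul_left ?_ hp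
    have h1 : (0 : ℝ) ≤ (leftEnd s).1 := Nat.cast_nonneg _
    simp only [leftEnd, List.foldr_cons, endStep] at hl h1 ⊢
    push_cast at hl
    linarith
  have h0 : 0 ≤ w := (Nat.cast_nonneg k).trans hk
  exact ⟨h0, (Nat.floor_eq_iff h0).2 ⟨hk, hlt⟩⟩

theorem Cyl.lt {k : ℕ} {s : List ℕ} {w : ℝ} (h : Cyl (k :: s) w) : w < k + 1 := by
  have hp : (0 : ℝ) < (rightEnd s).1 + (rightEnd s).2 := by
    have : (0 : ℝ) < (rightEnd s).1 := by exact_mod_cast rightEnd_pos s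
    positivity
  refine lt_of_mul_lt_mul_left ?_ hp.le
  have hr := h.2
  have h1 : (0 : ℝ) ≤ (rightEnd s).2 := Nat.cast_nonneg _
  simp only [rightEnd, List.foldr_cons, endStep] at hr h1 ⊢
  push_cast at hr
  linarith

theorem cyl_cons {k : ℕ} {s : List ℕ} {w : ℝ} (h0 : 0 ≤ w) :
    Cyl (k :: s) w ↔ ⌊w⌋₊ = k ∧ Cyl s (shift w) := by
  constructor
  · intro h
    have hk := (floor_eq_of_ends h.1 h.lt).2
    exact ⟨hk, (leftEnd_cons_le h0 hk).1 h.1, (lt_rightEnd_cons h0 hk).1 h.2⟩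
  · rintro ⟨hk, h⟩
    exact ⟨(leftEnd_cons_le h0 hk).2 h.1, (lt_rightEnd_cons h0 hk).2 h.2⟩

theorem digits_mem_baireNbhd {s : List ℕ} : ∀ {w : ℝ}, 0 ≤ w →
    (digits w ∈ baireNbhd s ↔ Cyl s w) := by
  induction s with
  | nil => intro w h0; simpa [baireNbhd, Cyl, leftEnd, rightEnd] using h0
  | cons k s ih =>
    intro w h0
    rw [mem_baireNbhd_cons, cyl_cons h0, ← ih (shift_nonneg w)]
    rfl

/-- One more digit replaces the right endpoint ∞ at the innermost level by a finite one, so even the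
closed cylinder of the longer word stays strictly below the right endpoint of the shorter one. -/
theorem ClosedCyl.cyl_of_append {s : List ℕ} : ∀ {k : ℕ} {w : ℝ},
    ClosedCyl (s ++ [k]) w → Cyl s w := by
  induction s with
  | nil =>
    intro k w h
    have h1 := h.1
    simp only [List.nil_append, leftEnd, List.foldr_cons, List.foldr_nil, endStep] at h1
    simp only [Cyl, leftEnd, rightEnd, List.foldr_nil]
    push_cast at h1 ⊢
    have : (0 : ℝ) ≤ k := Nat.cast_nonneg k
    constructor <;> linarith
  | cons k₀ s ih =>
    intro k w h
    have hlt : w < k₀ + 1 := by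
      -- A nonempty word has a finite right endpoint, and a finite `p / q` gives `p / (p + q) < 1`.
      have hq : 0 < (rightEnd (s ++ [k])).2 := by
        cases s with
        | nil => simp [rightEnd, endStep]
        | cons j s =>
          have := rightEnd_pos (s ++ [k])
          simp only [rightEnd, List.cons_append, List.foldr_cons, endStep] at this ⊢
          omega
      have hq : (0 : ℝ) < (rightEnd (s ++ [k])).2 := by exact_mod_cast hq
      have hp : (0 : ℝ) < (rightEnd (s ++ [k])).1 + (rightEnd (s ++ [k])).2 := by positivity
      refine lt_of_mul_lt_mul_left ?_ hp.le
      have hr := h.2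
      simp only [rightEnd, List.cons_append, List.foldr_cons, endStep] at hr hq ⊢
      push_cast at hr
      linarith
    obtain ⟨h0, hk⟩ := floor_eq_of_ends (s := s ++ [k]) h.1 hlt
    rw [cyl_cons h0]
    exact ⟨hk, ih ⟨(leftEnd_cons_le h0 hk).1 h.1, (le_rightEnd_cons h0 hk).1 h.2⟩⟩

theorem exists_cyl (s : List ℕ) : ∃ w : ℝ, 0 ≤ w ∧ Cyl s w := by
  induction s with
  | nil => exact ⟨0, le_rfl, by simp [Cyl, leftEnd, rightEnd]⟩
  | cons k s ih =>
    obtain ⟨w, h0, hw⟩ := ih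
    have hf : Int.fract (w / (1 + w)) = w / (1 + w) :=
      Int.fract_eq_self.2 ⟨by positivity, by rw [div_lt_one (by positivity)]; linarith⟩
    have hs : shift (k + w / (1 + w)) = w := by
      rw [shift, Int.fract_natCast_add, hf]
      have : (1 + w) ≠ 0 := by positivity
      field_simp
      ring
    have hpos : 0 ≤ k + w / (1 + w) := by positivity
    refine ⟨k + w / (1 + w), hpos, (cyl_cons hpos).2 ⟨?_, by rwa [hs]⟩⟩
    rw [Nat.floor_eq_iff hpos]
    have : w / (1 + w) < 1 := by rw [div_lt_one (by positivity)]; linarith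
    have : 0 ≤ w / (1 + w) := by positivity
    constructor <;> linarith

theorem Cyl.closedCyl {s : List ℕ} {w : ℝ} (h : Cyl s w) : ClosedCyl s w := ⟨h.1, h.2.le⟩

theorem isClosed_closedCyl (s : List ℕ) : IsClosed {w | ClosedCyl s w} :=
  IsClosed.and (isClosed_le continuous_const (continuous_const.mul continuous_id))
    (isClosed_le (continuous_const.mul continuous_id) continuous_const)

/-- The closed cylinders of the initial segments are nested, nonempty and eventually compact, so
they share a point. That point lies in every half-open cylinder because each contains the next
closed one. -/
theorem exists_digits_eq (α : ℕ → ℕ) : ∃ w : ℝ, 0 ≤ w ∧ digits w = α := by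
  let s : ℕ → List ℕ := fun n => (List.range n).map α
  have hs : ∀ n, s (n + 1) = s n ++ [α n] := fun n => by simp [s, List.range_succ]
  -- The sequence of sets starts at length 1, since the cylinder of the empty word is all of `[0,
  -- ∞)`.
  have hcomp : IsCompact {w | ClosedCyl (s 1) w} := by
    refine Metric.isCompact_of_isClosed_isBounded (isClosed_closedCyl _) ?_
    refine (Metric.isBounded_Icc (0 : ℝ) (α 0 + 1)).subset fun w hw => ?_
    obtain ⟨h1, h2⟩ := hw
    simp only [s, List.range_one, List.map_cons, List.map_nil, leftEnd, rightEnd,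
      List.foldr_cons, List.foldr_nil, endStep] at h1 h2
    push_cast at h1 h2
    have : (0 : ℝ) ≤ α 0 := Nat.cast_nonneg _
    constructor <;> linarith
  obtain ⟨w, hw⟩ := IsCompact.nonempty_iInter_of_sequence_nonempty_isCompact_isClosed
    (fun n => {w | ClosedCyl (s (n + 1)) w})
    (fun n w hw => by
      simp only [Set.mem_ofPred_eq] at hw ⊢
      rw [hs] at hw
      exact hw.cyl_of_append.closedCyl)
    (fun n => (exists_cyl (s (n + 1))).imp fun w hw => hw.2.closedCyl)
    hcomp (fun n => isClosed_closedCyl _)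
  have hcyl : ∀ n, Cyl (s n) w := fun n => by
    have := Set.mem_iInter.1 hw n
    rw [Set.mem_ofPred_eq, hs] at this
    exact this.cyl_of_append
  have h0 : 0 ≤ w := by simpa [s, leftEnd, Cyl, rightEnd] using hcyl 0
  refine ⟨w, h0, funext fun i => ?_⟩
  have := (digits_mem_baireNbhd h0).2 (hcyl (i + 1)) i (by simp [s])
  simpa [s] using this

theorem surjective_digits_sq : Function.Surjective fun z : ℝ => digits (z ^ 2) := fun α => by
  obtain ⟨w, h0, hw⟩ := exists_digits_eq α
  exact ⟨√w, by simp only [Real.sq_sqrt h0, hw]⟩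

/-! ### Primitive recursive enumeration -/

open Filter

/-- Read `n` as a candidate together with a step bound, and output the candidate if the bounded
evaluation halts. Allowing `none` covers the empty set. -/
theorem exists_primrec_enumeration {α : Type*} [Primcodable α] {p : α → Prop} (h : REPred p) :
    ∃ f : ℕ → Option α, Primrec f ∧ ∀ a, p a ↔ ∃ n, f n = some a := by
  obtain ⟨c, hc⟩ := Nat.Partrec.Code.exists_code.1 h
  have hp : ∀ a, p a ↔ ∃ k, (Nat.Partrec.Code.evaln k c (Encodable.encode a)).isSome := by
    intro a
    have h1 : p a ↔ (Nat.Partrec.Code.eval c (Encodable.encode a)).Dom := by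
      rw [hc]
      simp [Part.assert]
    rw [h1, Part.dom_iff_mem]
    simp only [Nat.Partrec.Code.evaln_complete, Option.isSome_iff_exists, Option.mem_def]
    exact exists_comm
  refine ⟨fun n => (Encodable.decode n.unpair.1 : Option α).bind fun a =>
    bif (Nat.Partrec.Code.evaln n.unpair.2 c (Encodable.encode a)).isSome then some a else none,
    ?_, fun a => ?_⟩
  · refine Primrec.option_bind (Primrec.decode.comp (Primrec.fst.comp Primrec.unpair)) ?_
    refine Primrec.cond (Primrec.option_isSome.comp
      (Nat.Partrec.Code.primrec_evaln.comp (Primrec.pair (Primrec.pair ?_ (Primrec.const c)) ?_)))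
      (Primrec.option_some.comp Primrec.snd) (Primrec.const none)
    · exact Primrec.snd.comp (Primrec.unpair.comp Primrec.fst)
    · exact Primrec.encode.comp Primrec.snd
  · rw [hp]
    constructor
    · rintro ⟨k, hk⟩
      exact ⟨Nat.pair (Encodable.encode a) k, by simp [hk]⟩
    · rintro ⟨n, hn⟩
      obtain ⟨b, -, hb⟩ := Option.bind_eq_some_iff.1 hn
      cases hk : (Nat.Partrec.Code.evaln n.unpair.2 c (Encodable.encode b)).isSome with
      | false => simp [hk] at hb
      | true =>
        simp only [hk, cond_true, Option.some.injEq] at hb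
        subst hb
        exact ⟨_, hk⟩

/-! ### Half-lines, closed approximations of boxes, and the open sets -/

/-- The closed half-line `e.2.2 ≤ e.1 * v + e.2.1`. -/
def Above (e : ℕ × ℕ × ℕ) (v : ℝ) : Prop := (e.2.2 : ℝ) ≤ e.1 * v + e.2.1

/-- The closed half-line `e.1 * v + e.2.1 ≤ e.2.2`. -/
def Below (e : ℕ × ℕ × ℕ) (v : ℝ) : Prop := (e.1 : ℝ) * v + e.2.1 ≤ e.2.2

/-- A decidable condition which guarantees that the half-line `Above e` misses the window
`|d * (v + h) - s| < 1`. -/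
def AboveFails (e : ℕ × ℕ × ℕ) (d h s : ℕ) : Prop :=
  e.1 * (s + 1) + d * e.2.1 < d * e.2.2 + e.1 * (d * h)

/-- A decidable condition which guarantees that the half-line `Below e` misses the window
`|d * (v + h) - s| < 1`. -/
def BelowFails (e : ℕ × ℕ × ℕ) (d h s : ℕ) : Prop :=
  d * e.2.2 + e.1 * (d * h) + e.1 < e.1 * s + d * e.2.1

theorem AboveFails.not_above {e : ℕ × ℕ × ℕ} {d h s : ℕ} {v : ℝ} (hf : AboveFails e d h s)
    (hw : |d * (v + h) - s| < 1) : ¬ Above e v := by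
  have hf' : (e.1 : ℝ) * (s + 1) + d * e.2.1 < d * e.2.2 + e.1 * (d * h) := by exact_mod_cast hf
  rw [Above, not_le]
  refine lt_of_mul_lt_mul_left ?_ (Nat.cast_nonneg d)
  have := mul_le_mul_of_nonneg_left (abs_lt.1 hw).2.le (Nat.cast_nonneg (α := ℝ) e.1)
  linarith

theorem BelowFails.not_below {e : ℕ × ℕ × ℕ} {d h s : ℕ} {v : ℝ} (hf : BelowFails e d h s)
    (hw : |d * (v + h) - s| < 1) : ¬ Below e v := by
  have hf' : (d : ℝ) * e.2.2 + e.1 * (d * h) + e.1 < e.1 * s + d * e.2.1 := by exact_mod_cast hf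
  rw [Below, not_le]
  refine lt_of_mul_lt_mul_left ?_ (Nat.cast_nonneg d)
  have := mul_le_mul_of_nonneg_left (abs_lt.1 hw).1.le (Nat.cast_nonneg (α := ℝ) e.1)
  linarith

/-- After scaling by `d`, the gap by which `v` misses the half-line grows linearly in `d`, while the
window costs at most `2 * e.1`. Any `d` beyond the quotient of these suffices. -/
theorem exists_aboveFails {e : ℕ × ℕ × ℕ} {v : ℝ} (hv : ¬ Above e v) :
    ∃ D : ℕ, ∀ d ≥ D, ∀ h s : ℕ, |d * (v + h) - s| < 1 → AboveFails e d h s := by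
  rw [Above, not_le, ← sub_pos] at hv
  obtain ⟨D, hD⟩ := exists_nat_gt ((2 * (e.1 : ℝ)) / (e.2.2 - (e.1 * v + e.2.1)))
  refine ⟨D, fun d hd h s hw => ?_⟩
  rw [div_lt_iff₀ hv] at hD
  have hd' : (D : ℝ) ≤ d := by exact_mod_cast hd
  have h1 := mul_le_mul_of_nonneg_right hd' hv.le
  have h2 := mul_le_mul_of_nonneg_left (abs_lt.1 hw).1.le (Nat.cast_nonneg (α := ℝ) e.1)
  have : (e.1 : ℝ) * (s + 1) + d * e.2.1 < d * e.2.2 + e.1 * (d * h) := by linarith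
  exact_mod_cast this

theorem exists_belowFails {e : ℕ × ℕ × ℕ} {v : ℝ} (hv : ¬ Below e v) :
    ∃ D : ℕ, ∀ d ≥ D, ∀ h s : ℕ, |d * (v + h) - s| < 1 → BelowFails e d h s := by
  rw [Below, not_le, ← sub_pos] at hv
  obtain ⟨D, hD⟩ := exists_nat_gt ((2 * (e.1 : ℝ)) / (e.1 * v + e.2.1 - e.2.2))
  refine ⟨D, fun d hd h s hw => ?_⟩
  rw [div_lt_iff₀ hv] at hD
  have hd' : (D : ℝ) ≤ d := by exact_mod_cast hd
  have h1 := mul_le_mul_of_nonneg_right hd' hv.le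
  have h2 := mul_le_mul_of_nonneg_left (abs_lt.1 hw).2.le (Nat.cast_nonneg (α := ℝ) e.1)
  have : (d : ℝ) * e.2.2 + e.1 * (d * h) + e.1 < e.1 * s + d * e.2.1 := by linarith
  exact_mod_cast this

/-- The lower constraints of the `t`-th closed approximation to the box with code `c`. -/
def lower {a m : ℕ} (c : Code a m) (t : ℕ) : Fin (a + m) → ℕ × ℕ × ℕ :=
  Fin.append
    (fun i => ((t + 1) * (1 + (c.1 i).1), (t + 1) * (c.1 i).2.2.1, 1 + (t + 1) * (c.1 i).2.1))
    (fun j => ((leftEnd (c.2 j)).2, 0, (leftEnd (c.2 j)).1))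

/-- The upper constraints of the `t`-th closed approximation to the box with code `c`. -/
def upper {a m : ℕ} (c : Code a m) (t : ℕ) : Fin (a + m) → ℕ × ℕ × ℕ :=
  Fin.append
    (fun i => ((t + 1) * (1 + (c.1 i).1), (t + 1) * (c.1 i).2.2.1 + 1,
      (t + 1) * ((c.1 i).2.1 + (c.1 i).2.2.2 + 1)))
    (fun j => ((t + 1) * (rightEnd (c.2 j)).2, 1, (t + 1) * (rightEnd (c.2 j)).1))

/-- The `t`-th closed approximation to the box with code `c`. -/
def Inside {a m : ℕ} (c : Code a m) (t : ℕ) (v : Fin (a + m) → ℝ) : Prop :=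
  ∀ i, Above (lower c t i) (v i) ∧ Below (upper c t i) (v i)

theorem pos_iff_eventually {u : ℝ} : 0 < u ↔ ∀ᶠ t : ℕ in atTop, 1 ≤ ((t : ℝ) + 1) * u := by
  constructor
  · intro hu
    obtain ⟨T, hT⟩ := exists_nat_gt (1 / u)
    filter_upwards [eventually_ge_atTop T] with t ht
    rw [div_lt_iff₀ hu] at hT
    have : (T : ℝ) ≤ t := by exact_mod_cast ht
    nlinarith
  · intro h
    obtain ⟨t, ht⟩ := h.exists
    exact pos_of_mul_pos_right (zero_lt_one.trans_le ht) (by positivity)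

theorem mem_realNbhd {c : ℕ × ℕ × ℕ × ℕ} {v : ℝ} : v ∈ realNbhd c ↔
    0 < (1 + (c.1 : ℝ)) * v + c.2.2.1 - c.2.1 ∧
      0 < (c.2.1 : ℝ) + c.2.2.2 + 1 - (1 + c.1) * v - c.2.2.1 := by
  have h : (0 : ℝ) < 1 + c.1 := by positivity
  rw [realNbhd, Set.mem_Ioo, div_lt_iff₀ h, lt_div_iff₀ h]
  constructor <;> rintro ⟨h1, h2⟩ <;> constructor <;> linarith

/-- Strict inequalities `0 < u` are weakened to `1 ≤ (t + 1) * u`, while the closed left ends of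
cylinders are kept. There are finitely many constraints, so one large `t` serves them all. -/
theorem mem_basicNbhd_iff {a m : ℕ} {c : Code a m} {x : Fin a → ℝ} {w : Fin m → ℝ}
    (hw : ∀ j, 0 ≤ w j) :
    ((x, fun j => digits (w j)) : Space a m) ∈ basicNbhd c ↔
      ∃ t, Inside c t (Fin.append x w) := by
  have key : ∀ t, Inside c t (Fin.append x w) ↔
      (∀ i, 1 ≤ ((t : ℝ) + 1) * ((1 + ((c.1 i).1 : ℝ)) * x i + (c.1 i).2.2.1 - (c.1 i).2.1) ∧
        1 ≤ ((t : ℝ) + 1) * (((c.1 i).2.1 : ℝ) + (c.1 i).2.2.2 + 1 - (1 + (c.1 i).1) * x i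
          - (c.1 i).2.2.1)) ∧
      ∀ j, ((leftEnd (c.2 j)).1 : ℝ) ≤ (leftEnd (c.2 j)).2 * w j ∧
        1 ≤ ((t : ℝ) + 1) * ((rightEnd (c.2 j)).1 - (rightEnd (c.2 j)).2 * w j) := by
    intro t
    simp only [Inside, Fin.forall_fin_add, lower, upper, Fin.append_left, Fin.append_right,
      Above, Below]
    push_cast
    refine and_congr (forall_congr' fun i => and_congr ?_ ?_)
      (forall_congr' fun j => and_congr ?_ ?_) <;> constructor <;> intro h <;> linarith
  have hbase : ((x, fun j => digits (w j)) : Space a m) ∈ basicNbhd c ↔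
      ∀ᶠ t in atTop, Inside c t (Fin.append x w) := by
    simp only [key, eventually_and, eventually_all, ← pos_iff_eventually, eventually_const]
    simp only [basicNbhd, Set.mem_ofPred_eq, mem_realNbhd, digits_mem_baireNbhd (hw _), Cyl,
      sub_pos]
  rw [hbase]
  refine ⟨fun h => h.exists, fun ⟨t, ht⟩ => ?_⟩
  rw [key] at ht
  simp only [key, eventually_and, eventually_all, ← pos_iff_eventually, eventually_const]
  have hpos : ∀ u : ℝ, 1 ≤ ((t : ℝ) + 1) * u → 0 < u := fun u hu =>
    pos_of_mul_pos_right (zero_lt_one.trans_le hu) (by positivity)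
  exact ⟨fun i => ⟨hpos _ (ht.1 i).1, hpos _ (ht.1 i).2⟩,
    fun j => ⟨(ht.2 j).1, hpos _ (ht.2 j).2⟩⟩

/-- The `n`-th of the open sets whose intersection is the matrix, for the enumeration `f` of
codes of boxes. -/
def OpenAt {a m : ℕ} (f : ℕ → Option (Code a m)) (n : ℕ) (v : Fin (a + m) → ℝ) : Prop :=
  ∀ c ∈ f n.unpair.1, ¬ Inside c n.unpair.2 v

theorem notMem_iff_forall_openAt {a m : ℕ} {U : Set (Space a m)} {W : Set (Code a m)}
    (hU : U = ⋃ c ∈ W, basicNbhd c) {f : ℕ → Option (Code a m)}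
    (hf : ∀ c, c ∈ W ↔ ∃ n, f n = some c) {x : Fin a → ℝ} {w : Fin m → ℝ}
    (hw : ∀ j, 0 ≤ w j) :
    ((x, fun j => digits (w j)) : Space a m) ∉ U ↔ ∀ n, OpenAt f n (Fin.append x w) := by
  subst hU
  simp only [Set.mem_iUnion, not_exists, mem_basicNbhd_iff hw, OpenAt, hf, Option.mem_def]
  constructor
  · intro h n c hc
    exact h c ⟨_, hc⟩ _
  · rintro h c ⟨n, hc⟩ t
    have := h (Nat.pair n t) c
    simp only [Nat.unpair_pair] at this
    exact this hc

/-! ### Certificates by simultaneous rational approximation -/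

/-- The decidable condition on `n` and on the approximation `g` (numerators, followed by the
denominator and the shift) that guarantees membership in the `n`-th open set. -/
def Good {a m : ℕ} (f : ℕ → Option (Code a m)) (n : ℕ) (g : Fin (a + m + 2) → ℕ) : Prop :=
  ∀ c ∈ f n.unpair.1, ∃ i : Fin (a + m),
    AboveFails (lower c n.unpair.2 i) (g (Fin.natAdd (a + m) 0)) (g (Fin.natAdd (a + m) 1))
      (g (Fin.castAdd 2 i)) ∨
    BelowFails (upper c n.unpair.2 i) (g (Fin.natAdd (a + m) 0)) (g (Fin.natAdd (a + m) 1))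
      (g (Fin.castAdd 2 i))

/-- The error of the approximation `g` to the `i`-th coordinate of `v`. -/
def err {M : ℕ} (g : Fin (M + 2) → ℕ) (v : Fin M → ℝ) (i : Fin M) : ℝ :=
  g (Fin.natAdd M 0) * (v i + g (Fin.natAdd M 1)) - g (Fin.castAdd 2 i)

theorem Good.openAt {a m : ℕ} {f : ℕ → Option (Code a m)} {n : ℕ} {g : Fin (a + m + 2) → ℕ}
    (hg : Good f n g) {v : Fin (a + m) → ℝ} (hv : ∀ i, |err g v i| < 1) : OpenAt f n v := by
  intro c hc hin
  obtain ⟨i, hi | hi⟩ := hg c hc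
  · exact hi.not_above (hv i) (hin i).1
  · exact hi.not_below (hv i) (hin i).2

/-- Recurrence on the torus: 0 is a cluster point of the multiples of any point, so some arbitrarily
late multiple is close to 0 in all coordinates. -/
theorem exists_simultaneous_approx {M : ℕ} (v : Fin M → ℝ) (D : ℕ) {ε : ℝ} (hε : 0 < ε) :
    ∃ d ≥ D, ∀ i, |d * v i - round (d * v i)| < ε := by
  have h := mapClusterPt_zero_atTop_nsmul (fun i => (v i : UnitAddCircle))
  have h2 := (mapClusterPt_iff_frequently.1 h _ (Metric.ball_mem_nhds 0 hε)).and_eventually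
    (eventually_ge_atTop D)
  obtain ⟨d, hd, hD⟩ := h2.exists
  refine ⟨d, hD, fun i => ?_⟩
  rw [mem_ball_zero_iff, pi_norm_lt_iff hε] at hd
  have := hd i
  rw [Pi.smul_apply, ← AddCircle.coe_nsmul, UnitAddCircle.norm_eq, nsmul_eq_mul] at this
  exact this

theorem OpenAt.exists_good {a m : ℕ} {f : ℕ → Option (Code a m)} {n : ℕ}
    {v : Fin (a + m) → ℝ} (hv : OpenAt f n v) {ε : ℝ} (hε : 0 < ε) :
    ∃ g, Good f n g ∧ ∀ i, |err g v i| < ε := by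
  obtain ⟨D, hD⟩ : ∃ D : ℕ, ∀ d ≥ D, ∀ (h : ℕ) (s : Fin (a + m) → ℕ),
      (∀ i, |d * (v i + h) - s i| < 1) → ∀ c ∈ f n.unpair.1, ∃ i : Fin (a + m),
        AboveFails (lower c n.unpair.2 i) d h (s i) ∨
        BelowFails (upper c n.unpair.2 i) d h (s i) := by
    cases hc : f n.unpair.1 with
    | none => exact ⟨0, by simp⟩
    | some c =>
      have h1 := hv c hc
      rw [Inside, not_forall] at h1
      obtain ⟨i, hi⟩ := h1
      rw [not_and_or] at hi
      rcases hi with hi | hi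
      · obtain ⟨D, hD⟩ := exists_aboveFails hi
        refine ⟨D, fun d hd h s hs c' hc' => ⟨i, Or.inl ?_⟩⟩
        cases hc'
        exact hD d hd h _ (hs i)
      · obtain ⟨D, hD⟩ := exists_belowFails hi
        refine ⟨D, fun d hd h s hs c' hc' => ⟨i, Or.inr ?_⟩⟩
        cases hc'
        exact hD d hd h _ (hs i)
  -- The shift makes all coordinates at least 1, so that the numerators, obtained by rounding, are
  -- natural numbers.
  obtain ⟨h, hh⟩ : ∃ h : ℕ, ∀ i, 1 ≤ v i + h := by
    obtain ⟨h, hh⟩ := exists_nat_ge (1 + ∑ i, |v i|)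
    refine ⟨h, fun i => ?_⟩
    have := Finset.single_le_sum (f := fun i => |v i|) (fun i _ => abs_nonneg _)
      (Finset.mem_univ i)
    linarith [neg_abs_le (v i)]
  obtain ⟨d, hd, hr⟩ := exists_simultaneous_approx (fun i => v i + h) (max D 1)
    (lt_min hε one_pos)
  have hs : ∀ i, ∃ s : ℕ, (s : ℤ) = round (d * (v i + h)) := fun i => by
    refine ⟨_, Int.toNat_of_nonneg ?_⟩
    have h1 : (1 : ℝ) ≤ d := by exact_mod_cast (le_max_right D 1).trans hd
    have h2 : 1 ≤ d * (v i + h) := by nlinarith [hh i]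
    have h3 := (abs_lt.1 ((hr i).trans_le (min_le_right _ _))).2
    have : (0 : ℝ) < round (d * (v i + h)) := by linarith
    exact_mod_cast this.le
  choose s hs using hs
  have hs' : ∀ i, |d * (v i + h) - s i| < min ε 1 := fun i => by
    have := hr i
    rw [← hs i] at this
    exact_mod_cast this
  refine ⟨Fin.append s ![d, h], fun c hc => ?_, fun i => ?_⟩
  · simpa only [Fin.append_left, Fin.append_right, Matrix.cons_val_zero, Matrix.cons_val_one]
      using hD d ((le_max_left D 1).trans hd) h s
        (fun i => (hs' i).trans_le (min_le_right _ _)) c hc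
  · simp only [err, Fin.append_left, Fin.append_right, Matrix.cons_val_zero, Matrix.cons_val_one]
    exact (hs' i).trans_le (min_le_left _ _)

/-! ### Polynomial coding of tuples -/

/-- The injective polynomial pairing `(c + s)² + s`. -/
def sqPair (c s : ℕ) : ℕ := (c + s) ^ 2 + s

/-- The second component of a value of `sqPair`. -/
def sqRight (N : ℕ) : ℕ := N - N.sqrt ^ 2

/-- The first component of a value of `sqPair`. -/
def sqLeft (N : ℕ) : ℕ := N.sqrt - (N - N.sqrt ^ 2)

/-- Since `s ≤ 2 * (c + s)`, the value lies below the next square. -/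
theorem sqrt_sqPair (c s : ℕ) : (sqPair c s).sqrt = c + s := by
  rw [sqPair, sq]
  exact Nat.sqrt_add_eq _ (by omega)

theorem sqRight_sqPair (c s : ℕ) : sqRight (sqPair c s) = s := by
  rw [sqRight, sqrt_sqPair, sqPair]; omega

theorem sqLeft_sqPair (c s : ℕ) : sqLeft (sqPair c s) = c := by
  rw [sqLeft, sqrt_sqPair, sqPair]; omega

/-- The code of the tuple consisting of `n` and the first `j` entries of `g`. -/
def chain {L : ℕ} (n : ℕ) (g : Fin L → ℕ) : (j : ℕ) → j ≤ L → ℕ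
  | 0, _ => n
  | j + 1, h => sqPair (chain n g j (Nat.le_of_succ_le h)) (g ⟨j, h⟩)

theorem iterate_sqLeft_chain {L : ℕ} (n : ℕ) (g : Fin L → ℕ) {i : ℕ} :
    ∀ (j : ℕ) (h : i + j ≤ L), sqLeft^[j] (chain n g (i + j) h) =
      chain n g i (le_of_add_le_left h)
  | 0, _ => rfl
  | j + 1, h => by
    rw [Function.iterate_succ_apply]
    have : sqLeft (chain n g (i + (j + 1)) h) = chain n g (i + j) (by omega) :=
      sqLeft_sqPair _ _
    rw [this, iterate_sqLeft_chain n g j]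

/-- The tuple `g` decoded from its code `N`. -/
def unchain (L : ℕ) (N : ℕ) (i : Fin L) : ℕ := sqRight (sqLeft^[L - 1 - i] N)

theorem unchain_chain {L : ℕ} (n : ℕ) (g : Fin L → ℕ) :
    unchain L (chain n g L le_rfl) = g := by
  funext i
  have h : (i : ℕ) + 1 + (L - 1 - i) = L := by omega
  have h2 : chain n g L le_rfl = chain n g (i + 1 + (L - 1 - i)) h.le := by congr 1; exact h.symm
  rw [unchain, h2, iterate_sqLeft_chain]
  exact sqRight_sqPair _ _

theorem iterate_sqLeft_chain_self {L : ℕ} (n : ℕ) (g : Fin L → ℕ) :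
    sqLeft^[L] (chain n g L le_rfl) = n := by
  have h2 : chain n g L le_rfl = chain n g (0 + L) (Nat.zero_add L).le := by
    congr 1; exact (Nat.zero_add L).symm
  rw [h2, iterate_sqLeft_chain]
  rfl

/-! ### Computability of the certificate condition -/

theorem primrec_sqRight : Primrec sqRight :=
  (Primrec.nat_sub.comp Primrec.id (Primrec.nat_mul.comp Primrec.nat_sqrt Primrec.nat_sqrt)).of_eq
    fun N => by simp [sqRight, sq]

theorem primrec_sqLeft : Primrec sqLeft :=
  Primrec.nat_sub.comp Primrec.nat_sqrt primrec_sqRight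

theorem primrec_iterate_sqLeft (j : ℕ) : Primrec fun N => sqLeft^[j] N :=
  Primrec.nat_iterate (Primrec.const j) Primrec.id (primrec_sqLeft.comp Primrec.snd).to₂

theorem primrec_unchain {L : ℕ} (i : Fin L) : Primrec fun N => unchain L N i :=
  primrec_sqRight.comp (primrec_iterate_sqLeft _)

theorem primrec_fin_apply {α σ : Type*} [Primcodable α] [Primcodable σ] {k : ℕ}
    {F : α → Fin k → σ} (hF : Primrec F) (i : Fin k) : Primrec fun x => F x i :=
  Primrec.fin_app.comp hF (Primrec.const i)

theorem primrec_endStep : Primrec₂ endStep := by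
  have h1 : Primrec fun p : ℕ × ℕ × ℕ => p.2.1 + p.2.2 :=
    Primrec.nat_add.comp (Primrec.fst.comp Primrec.snd) (Primrec.snd.comp Primrec.snd)
  exact (Primrec.nat_add.comp (Primrec.nat_mul.comp Primrec.fst h1)
    (Primrec.fst.comp Primrec.snd)).pair h1

theorem primrec_foldr_endStep (e : ℕ × ℕ) : Primrec fun s : List ℕ => s.foldr endStep e :=
  Primrec.list_foldr Primrec.id (Primrec.const e) (primrec_endStep.comp
    (Primrec.fst.comp Primrec.snd) (Primrec.snd.comp Primrec.snd)).to₂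

theorem primrecPred_exists_fin {α : Type*} [Primcodable α] : ∀ {k : ℕ} {P : Fin k → α → Prop},
    (∀ i, PrimrecPred (P i)) → PrimrecPred fun x => ∃ i, P i x
  | 0, _, _ => (PrimrecPred.not (Primrec.eq.comp (Primrec.const 0) (Primrec.const 0))).of_eq
      fun x => by simp
  | k + 1, P, h => ((h 0).or (primrecPred_exists_fin fun i : Fin k => h i.succ)).of_eq
      fun x => (Fin.exists_fin_succ (P := fun i => P i x)).symm

section Bounds

variable {α : Type*} [Primcodable α] {a m : ℕ} {C : α → Code a m} {t d h s : α → ℕ}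
  {e : α → ℕ × ℕ × ℕ}

theorem primrec_lower (hC : Primrec C) (ht : Primrec t) (i : Fin (a + m)) :
    Primrec fun x => lower (C x) (t x) i := by
  have hT : Primrec fun x => t x + 1 := Primrec.succ.comp ht
  refine Fin.addCases (fun i => ?_) (fun j => ?_) i
  · simp only [lower, Fin.append_left]
    have hc : Primrec fun x => (C x).1 i := primrec_fin_apply (Primrec.fst.comp hC) i
    refine Primrec.pair (Primrec.nat_mul.comp hT (Primrec.nat_add.comp (Primrec.const 1)
      (Primrec.fst.comp hc))) (Primrec.pair (Primrec.nat_mul.comp hT ?_)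
      (Primrec.nat_add.comp (Primrec.const 1) (Primrec.nat_mul.comp hT ?_)))
    · exact Primrec.fst.comp (Primrec.snd.comp (Primrec.snd.comp hc))
    · exact Primrec.fst.comp (Primrec.snd.comp hc)
  · simp only [lower, Fin.append_right]
    have hc : Primrec fun x => leftEnd ((C x).2 j) :=
      (primrec_foldr_endStep _).comp (primrec_fin_apply (Primrec.snd.comp hC) j)
    exact (Primrec.snd.comp hc).pair ((Primrec.const 0).pair (Primrec.fst.comp hc))

theorem primrec_upper (hC : Primrec C) (ht : Primrec t) (i : Fin (a + m)) :
    Primrec fun x => upper (C x) (t x) i := by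
  have hT : Primrec fun x => t x + 1 := Primrec.succ.comp ht
  refine Fin.addCases (fun i => ?_) (fun j => ?_) i
  · simp only [upper, Fin.append_left]
    have hc : Primrec fun x => (C x).1 i := primrec_fin_apply (Primrec.fst.comp hC) i
    refine Primrec.pair (Primrec.nat_mul.comp hT (Primrec.nat_add.comp (Primrec.const 1)
      (Primrec.fst.comp hc))) (Primrec.pair (Primrec.succ.comp (Primrec.nat_mul.comp hT ?_))
      (Primrec.nat_mul.comp hT (Primrec.succ.comp (Primrec.nat_add.comp ?_ ?_))))
    · exact Primrec.fst.comp (Primrec.snd.comp (Primrec.snd.comp hc))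
    · exact Primrec.fst.comp (Primrec.snd.comp hc)
    · exact Primrec.snd.comp (Primrec.snd.comp (Primrec.snd.comp hc))
  · simp only [upper, Fin.append_right]
    have hc : Primrec fun x => rightEnd ((C x).2 j) :=
      (primrec_foldr_endStep _).comp (primrec_fin_apply (Primrec.snd.comp hC) j)
    exact (Primrec.nat_mul.comp hT (Primrec.snd.comp hc)).pair ((Primrec.const 1).pair
      (Primrec.nat_mul.comp hT (Primrec.fst.comp hc)))

theorem primrecPred_aboveFails (he : Primrec e) (hd : Primrec d) (hh : Primrec h)
    (hs : Primrec s) : PrimrecPred fun x => AboveFails (e x) (d x) (h x) (s x) :=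
  Primrec.nat_lt.comp
    (Primrec.nat_add.comp (Primrec.nat_mul.comp (Primrec.fst.comp he) (Primrec.succ.comp hs))
      (Primrec.nat_mul.comp hd (Primrec.fst.comp (Primrec.snd.comp he))))
    (Primrec.nat_add.comp (Primrec.nat_mul.comp hd (Primrec.snd.comp (Primrec.snd.comp he)))
      (Primrec.nat_mul.comp (Primrec.fst.comp he) (Primrec.nat_mul.comp hd hh)))

theorem primrecPred_belowFails (he : Primrec e) (hd : Primrec d) (hh : Primrec h)
    (hs : Primrec s) : PrimrecPred fun x => BelowFails (e x) (d x) (h x) (s x) :=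
  Primrec.nat_lt.comp
    (Primrec.nat_add.comp (Primrec.nat_add.comp
      (Primrec.nat_mul.comp hd (Primrec.snd.comp (Primrec.snd.comp he)))
      (Primrec.nat_mul.comp (Primrec.fst.comp he) (Primrec.nat_mul.comp hd hh)))
      (Primrec.fst.comp he))
    (Primrec.nat_add.comp (Primrec.nat_mul.comp (Primrec.fst.comp he) hs)
      (Primrec.nat_mul.comp hd (Primrec.fst.comp (Primrec.snd.comp he))))

end Bounds

theorem primrecPred_forall_mem_option {α σ : Type*} [Primcodable α] [Primcodable σ]
    {o : α → Option σ} (ho : Primrec o) {P : α × σ → Prop} (hP : PrimrecPred P) :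
    PrimrecPred fun x => ∀ c ∈ o x, P (x, c) := by
  classical
  refine (Primrec.eq.comp (Primrec.option_casesOn ho (Primrec.const true)
    (g := fun x c => decide (P (x, c))) hP.decide) (Primrec.const true)).of_eq fun x => ?_
  cases o x <;> simp

/-- This is the set of naturals to which the universal polynomial is applied. It is even primitive
recursive, as `Good` only compares natural numbers over finitely many coordinates. -/
theorem rePred_good {a m : ℕ} {f : ℕ → Option (Code a m)} (hf : Primrec f) :
    REPred fun N => Good f (sqLeft^[a + m + 2] N) (unchain (a + m + 2) N) := by
  refine ComputablePred.to_re (PrimrecPred.computablePred ?_)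
  have hn : Primrec fun N => (sqLeft^[a + m + 2] N).unpair :=
    Primrec.unpair.comp (primrec_iterate_sqLeft _)
  have hC : Primrec (Prod.snd : ℕ × Code a m → Code a m) := Primrec.snd
  have ht : Primrec fun p : ℕ × Code a m => (sqLeft^[a + m + 2] p.1).unpair.2 :=
    Primrec.snd.comp (hn.comp Primrec.fst)
  have hu : ∀ i, Primrec fun p : ℕ × Code a m => unchain (a + m + 2) p.1 i := fun i =>
    (primrec_unchain i).comp Primrec.fst
  exact primrecPred_forall_mem_option (hf.comp (Primrec.fst.comp hn))
    (primrecPred_exists_fin fun i =>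
      (primrecPred_aboveFails (primrec_lower hC ht i) (hu _) (hu _) (hu _)).or
        (primrecPred_belowFails (primrec_upper hC ht i) (hu _) (hu _) (hu _)))

/-! ### The polynomial and its degree -/

open MvPolynomial

/-- Parameters of weight 0 are replaced by constants, so only the degree in the unknowns and `n`
matters. -/
theorem totalDegree_aeval_le_weightedTotalDegree {σ τ : Type*} {w : σ → ℕ}
    {G : σ → MvPolynomial τ ℤ} (hG : ∀ i, (G i).totalDegree ≤ w i) (q : MvPolynomial σ ℤ) :
    (aeval G q).totalDegree ≤ q.weightedTotalDegree w := by
  rw [aeval_def, eval₂_eq]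
  refine totalDegree_finsetSum_le fun e he => ?_
  refine (totalDegree_mul _ _).trans ?_
  rw [algebraMap_eq, totalDegree_C, zero_add]
  refine (totalDegree_finsetProd _ _).trans ?_
  refine le_trans ?_ (le_weightedTotalDegree w he)
  rw [Finsupp.weight_apply, Finsupp.sum]
  exact Finset.sum_le_sum fun i _ => (totalDegree_pow _ _).trans
    (Nat.mul_le_mul_left _ (hG i))

/-- The unknowns over the naturals: a switch and a padding variable, the partial codes, the
approximation, and the unknowns of the universal polynomial. -/
abbrev Unknown (L ν : ℕ) : Type := Fin 2 ⊕ Fin L ⊕ Fin L ⊕ Fin ν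

/-- All the variables. -/
abbrev Var (a m L ν : ℕ) : Type := Fin a ⊕ Fin m ⊕ Unit ⊕ Unknown L ν

section Polynomials

variable {a m L ν μ : ℕ}

/-- The switch variable. -/
def switchVar : Var a m L ν := .inr (.inr (.inr (.inl 0)))

/-- The padding variable. -/
def padVar : Var a m L ν := .inr (.inr (.inr (.inl 1)))

/-- The variables for the partial codes, starting with the outer variable `n`. -/
def codeVar : Fin (L + 1) → Var a m L ν :=
  Fin.cons (.inr (.inr (.inl ()))) fun i => .inr (.inr (.inr (.inr (.inl i))))

/-- The variables for the approximation. -/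
def approxVar (i : Fin L) : Var a m L ν := .inr (.inr (.inr (.inr (.inr (.inl i)))))

/-- The variables for the unknowns of the universal polynomial. -/
def univVar (i : Fin ν) : Var a m L ν := .inr (.inr (.inr (.inr (.inr (.inr i)))))

/-- The coordinates of the point that is approximated. -/
noncomputable def coord : Fin (a + m) → MvPolynomial (Var a m L ν) ℤ :=
  Fin.append (fun i => X (.inl i)) (fun j => X (.inr (.inl j)) ^ 2)

/-- The substitution into the universal polynomial. -/
noncomputable def univSubst (par : Fin μ → ℕ) :
    Fin ν ⊕ Unit ⊕ Fin μ → MvPolynomial (Var a m L ν) ℤ :=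
  Sum.elim (fun i => X (univVar i))
    (Sum.elim (fun _ => X (codeVar (Fin.last L))) (fun j => C (par j : ℤ)))

/-- The part of the penalty which forces the codes to be correct. -/
noncomputable def chainPoly : MvPolynomial (Var a m L ν) ℤ :=
  ∑ i : Fin L, (X (codeVar i.succ) -
    ((X (codeVar i.castSucc) + X (approxVar i)) ^ 2 + X (approxVar i))) ^ 2

/-- The part of the penalty which measures the quality of the approximation. -/
noncomputable def errPoly : MvPolynomial (Var a m (a + m + 2) ν) ℤ :=
  ∑ i : Fin (a + m), (X (approxVar (Fin.natAdd (a + m) 0)) *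
    (coord i + X (approxVar (Fin.natAdd (a + m) 1))) - X (approxVar (Fin.castAdd 2 i))) ^ 2

/-- The penalty. -/
noncomputable def penalty (q : MvPolynomial (Fin ν ⊕ Unit ⊕ Fin μ) ℤ) (par : Fin μ → ℕ) :
    MvPolynomial (Var a m (a + m + 2) ν) ℤ :=
  aeval (univSubst par) q + chainPoly + errPoly

/-- The polynomial `u * (2 - u - penalty) - u * t ^ r`. -/
noncomputable def mainPoly (q : MvPolynomial (Fin ν ⊕ Unit ⊕ Fin μ) ℤ) (par : Fin μ → ℕ)
    (r : ℕ) : MvPolynomial (Var a m (a + m + 2) ν) ℤ :=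
  X switchVar * (2 - X switchVar - penalty q par) - X switchVar * X padVar ^ r

theorem totalDegree_coord_le (i : Fin (a + m)) :
    (coord i : MvPolynomial (Var a m L ν) ℤ).totalDegree ≤ 2 := by
  refine Fin.addCases (fun i => ?_) (fun j => ?_) i
  · rw [coord, Fin.append_left, totalDegree_X]; omega
  · rw [coord, Fin.append_right, totalDegree_X_pow]

/-- The partial codes are unknowns of their own, so each link is a quadratic equation, squared.
Composing the pairings instead would let the degree grow with `L`. -/
theorem totalDegree_chainPoly_le :
    (chainPoly : MvPolynomial (Var a m L ν) ℤ).totalDegree ≤ 4 := by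
  refine totalDegree_finsetSum_le fun i _ => ?_
  refine (totalDegree_pow _ _).trans (Nat.mul_le_mul_left 2 (m := 2) ?_)
  refine (totalDegree_sub _ _).trans (max_le ?_ ?_)
  · rw [totalDegree_X]; omega
  refine (totalDegree_add _ _).trans (max_le ?_ ?_)
  · refine (totalDegree_pow _ _).trans (Nat.mul_le_mul_left 2 (m := 1) ?_)
    refine (totalDegree_add _ _).trans (max_le ?_ ?_) <;> rw [totalDegree_X]
  · rw [totalDegree_X]; omega

/-- A denominator times the square of a real variable has degree 3, and the error is squared. This
is the source of the 7 in the final degree. -/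
theorem totalDegree_errPoly_le :
    (errPoly : MvPolynomial (Var a m (a + m + 2) ν) ℤ).totalDegree ≤ 6 := by
  refine totalDegree_finsetSum_le fun i _ => ?_
  refine (totalDegree_pow _ _).trans (Nat.mul_le_mul_left 2 (m := 3) ?_)
  refine (totalDegree_sub _ _).trans (max_le ?_ ?_)
  · refine (totalDegree_mul _ _).trans (Nat.add_le_add (b := 1) (d := 2) ?_ ?_)
    · rw [totalDegree_X]
    · refine (totalDegree_add _ _).trans (max_le (totalDegree_coord_le i) ?_)
      rw [totalDegree_X]; omega
  · rw [totalDegree_X]; omega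

theorem totalDegree_penalty_le {q : MvPolynomial (Fin ν ⊕ Unit ⊕ Fin μ) ℤ} {par : Fin μ → ℕ} :
    (penalty q par : MvPolynomial (Var a m (a + m + 2) ν) ℤ).totalDegree ≤
      max (degreeUnknowns q) 6 := by
  refine (totalDegree_add _ _).trans (max_le ((totalDegree_add _ _).trans (max_le ?_ ?_)) ?_)
  · refine le_max_of_le_left (totalDegree_aeval_le_weightedTotalDegree ?_ q)
    rintro (i | i | j)
    · exact (totalDegree_X _).le
    · exact (totalDegree_X _).le
    · exact (totalDegree_C _).le
  · exact totalDegree_chainPoly_le.trans (by omega)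
  · exact totalDegree_errPoly_le.trans (by omega)

theorem totalDegree_mainPoly_le {q : MvPolynomial (Fin ν ⊕ Unit ⊕ Fin μ) ℤ} {par : Fin μ → ℕ}
    {r : ℕ} (hr : 6 ≤ r) (hq : degreeUnknowns q ≤ r) :
    (mainPoly q par r : MvPolynomial (Var a m (a + m + 2) ν) ℤ).totalDegree ≤ r + 1 := by
  refine (totalDegree_sub _ _).trans (max_le ?_ ?_)
  · refine (totalDegree_mul _ _).trans ?_
    rw [totalDegree_X, add_comm]
    refine Nat.add_le_add_right ?_ 1
    refine (totalDegree_sub _ _).trans (max_le ((totalDegree_sub _ _).trans (max_le ?_ ?_)) ?_)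
    · rw [show (2 : MvPolynomial (Var a m (a + m + 2) ν) ℤ) = C 2 by simp, totalDegree_C]
      omega
    · rw [totalDegree_X]; omega
    · exact totalDegree_penalty_le.trans (max_le hq hr)
  · refine (totalDegree_mul _ _).trans ?_
    rw [totalDegree_X, totalDegree_X_pow, add_comm]

/-- The substitution that keeps only the switch and the padding variable. -/
noncomputable def keepSwitch : Var a m L ν → Polynomial ℤ :=
  Sum.elim 0 (Sum.elim 0 (Sum.elim 0 (Sum.elim (fun _ => Polynomial.X)
    (Sum.elim 0 (Sum.elim 0 0)))))

theorem keepSwitch_codeVar (i : Fin (L + 1)) :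
    keepSwitch (codeVar i : Var a m L ν) = 0 := by
  refine Fin.cases ?_ (fun i => ?_) i <;> rfl

theorem keepSwitch_approxVar (i : Fin L) :
    keepSwitch (approxVar i : Var a m L ν) = 0 := rfl

theorem natDegree_keepSwitch_penalty {q : MvPolynomial (Fin ν ⊕ Unit ⊕ Fin μ) ℤ}
    {par : Fin μ → ℕ} :
    (aeval keepSwitch (penalty q par : MvPolynomial (Var a m (a + m + 2) ν) ℤ)).natDegree = 0 := by
  have h1 : aeval keepSwitch (chainPoly : MvPolynomial (Var a m (a + m + 2) ν) ℤ) = 0 := by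
    simp [chainPoly, keepSwitch_codeVar, keepSwitch_approxVar]
  have h2 : aeval keepSwitch (errPoly : MvPolynomial (Var a m (a + m + 2) ν) ℤ) = 0 := by
    simp [errPoly, keepSwitch_approxVar]
  rw [penalty, map_add, map_add, h1, h2, add_zero, add_zero, comp_aeval_apply]
  refine Nat.le_zero.1 ((aeval_natDegree_le q le_rfl _ (n := 0) ?_).trans (by simp))
  rintro (i | i | j)
  · simp [univSubst, univVar, keepSwitch]
  · simp [univSubst, keepSwitch_codeVar]
  · simp [univSubst]

/-- For the lower bound, set the switch and padding variables to `X` and all others to 0. The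
penalty involves neither of the two, so it becomes constant and `-X ^ (r + 1)` cannot cancel. -/
theorem totalDegree_mainPoly {q : MvPolynomial (Fin ν ⊕ Unit ⊕ Fin μ) ℤ} {par : Fin μ → ℕ}
    {r : ℕ} (hr : 6 ≤ r) (hq : degreeUnknowns q ≤ r) :
    (mainPoly q par r : MvPolynomial (Var a m (a + m + 2) ν) ℤ).totalDegree = r + 1 := by
  refine le_antisymm (totalDegree_mainPoly_le hr hq) ?_
  have hle := aeval_natDegree_le
    (mainPoly q par r : MvPolynomial (Var a m (a + m + 2) ν) ℤ) le_rfl keepSwitch (n := 1) (by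
      rintro (i | i | i | i | i | i | i) <;> simp [keepSwitch])
  rw [mul_one] at hle
  refine le_trans ?_ hle
  have hs : keepSwitch (switchVar : Var a m (a + m + 2) ν) = Polynomial.X := rfl
  have hp : keepSwitch (padVar : Var a m (a + m + 2) ν) = Polynomial.X := rfl
  simp only [mainPoly, map_sub, map_mul, map_pow, aeval_X, hs, hp, map_ofNat]
  rw [Polynomial.eq_C_of_natDegree_eq_zero natDegree_keepSwitch_penalty, ← pow_succ']
  refine Polynomial.le_natDegree_of_ne_zero ?_
  rw [Polynomial.coeff_sub, Polynomial.coeff_X_pow_self, Polynomial.coeff_X_mul,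
    Polynomial.coeff_eq_zero_of_natDegree_lt, zero_sub]
  · norm_num
  · refine lt_of_le_of_lt (b := 1) ?_ (by omega)
    rw [show (2 : Polynomial ℤ) = Polynomial.C 2 by simp]
    compute_degree

/-! ### Small penalties and certificates -/

/-- The real values of the variables. -/
def assign (x : Fin a → ℝ) (z : Fin m → ℝ) (n : ℕ) (k : Unknown L ν → ℕ) : Var a m L ν → ℝ :=
  Sum.elim x (Sum.elim z (Sum.elim (fun _ => (n : ℝ)) (fun i => (k i : ℝ))))

variable {x : Fin a → ℝ} {z : Fin m → ℝ} {n : ℕ}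

/-- The values of the partial codes. -/
def codes (n : ℕ) (k : Unknown L ν → ℕ) : Fin (L + 1) → ℕ :=
  Fin.cons n fun i => k (.inr (.inl i))

/-- The values of the approximation variables. -/
def approx (k : Unknown L ν → ℕ) (i : Fin L) : ℕ := k (.inr (.inr (.inl i)))

theorem assign_codeVar {k : Unknown L ν → ℕ} (i : Fin (L + 1)) :
    assign x z n k (codeVar i) = codes n k i := by
  refine Fin.cases ?_ (fun i => ?_) i <;> rfl

theorem assign_approxVar {k : Unknown L ν → ℕ} (i : Fin L) :
    assign x z n k (approxVar i) = approx k i := rfl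

theorem aeval_coord {k : Unknown L ν → ℕ} (i : Fin (a + m)) :
    aeval (assign x z n k) (coord i) = Fin.append x (fun j => z j ^ 2) i := by
  refine Fin.addCases (fun i => ?_) (fun j => ?_) i
  · simp [coord, assign]
  · simp [coord, assign]

theorem aeval_penalty {q : MvPolynomial (Fin ν ⊕ Unit ⊕ Fin μ) ℤ} {par : Fin μ → ℕ}
    {k : Unknown (a + m + 2) ν → ℕ} :
    aeval (assign x z n k) (penalty q par) =
      (evalParam q (fun i => k (.inr (.inr (.inr i)))) (codes n k (Fin.last _)) par : ℝ) +
      ((∑ i : Fin (a + m + 2), ((codes n k i.succ : ℤ) -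
        sqPair (codes n k i.castSucc) (approx k i)) ^ 2 : ℤ) : ℝ) +
      ∑ i, err (approx k) (Fin.append x fun j => z j ^ 2) i ^ 2 := by
  rw [penalty, map_add, map_add]
  congr 1
  · congr 1
    · rw [comp_aeval_apply, evalParam, ← eq_intCast (algebraMap ℤ ℝ), ← coe_aeval_eq_eval,
        RingHom.coe_coe, ← aeval_algebraMap_apply]
      congr 2
      · funext i
        rcases i with i | i | j
        · simp [univSubst, univVar, assign]
        · simp [univSubst, assign_codeVar]
        · simp [univSubst]
    · simp [chainPoly, assign_codeVar, assign_approxVar, sqPair]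
  · simp [errPoly, aeval_coord, assign_approxVar, err]

theorem eq_chain_of_forall {g : Fin L → ℕ} {c : Fin (L + 1) → ℕ} (h0 : c 0 = n)
    (h : ∀ i : Fin L, c i.succ = sqPair (c i.castSucc) (g i)) :
    ∀ (j : ℕ) (hj : j ≤ L), c ⟨j, Nat.lt_succ_of_le hj⟩ = chain n g j hj
  | 0, _ => h0
  | j + 1, hj => by
    rw [chain, ← eq_chain_of_forall h0 h j]
    exact h ⟨j, hj⟩

/-- A small penalty yields a good approximation. -/
theorem good_of_penalty_lt_one {f : ℕ → Option (Code a m)}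
    {q : MvPolynomial (Fin ν ⊕ Unit ⊕ Fin μ) ℤ} {par : Fin μ → ℕ}
    (hnn : ∀ y N, 0 ≤ evalParam q y N par)
    (hW : ∀ N, Good f (sqLeft^[a + m + 2] N) (unchain (a + m + 2) N) ↔
      ∃ y, evalParam q y N par = 0)
    {k : Unknown (a + m + 2) ν → ℕ} (hk : aeval (assign x z n k) (penalty q par) < 1) :
    Good f n (approx k) ∧ ∀ i, |err (approx k) (Fin.append x fun j => z j ^ 2) i| < 1 := by
  rw [aeval_penalty] at hk
  have h1 := hnn (fun i => k (.inr (.inr (.inr i)))) (codes n k (Fin.last _))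
  have h2 : 0 ≤ ∑ i : Fin (a + m + 2), ((codes n k i.succ : ℤ) -
    sqPair (codes n k i.castSucc) (approx k i)) ^ 2 := Finset.sum_nonneg fun _ _ => sq_nonneg _
  have h3 : 0 ≤ ∑ i, err (approx k) (Fin.append x fun j => z j ^ 2) i ^ 2 :=
    Finset.sum_nonneg fun _ _ => sq_nonneg _
  have h1' : (0 : ℝ) ≤ (evalParam q (fun i => k (.inr (.inr (.inr i))))
    (codes n k (Fin.last _)) par : ℝ) := by exact_mod_cast h1
  have h2' := Int.cast_nonneg (R := ℝ) h2
  -- All summands are nonnegative, so this integer lies in `[0, 1)`. The same argument kills the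
  -- packing sum.
  have e1 : evalParam q (fun i => k (.inr (.inr (.inr i)))) (codes n k (Fin.last _)) par = 0 := by
    refine le_antisymm (Int.lt_add_one_iff.1 ?_) h1
    rw [zero_add]
    exact_mod_cast (by linarith : (evalParam q (fun i => k (.inr (.inr (.inr i))))
      (codes n k (Fin.last _)) par : ℝ) < 1)
  have e2 : ∑ i : Fin (a + m + 2), ((codes n k i.succ : ℤ) -
      sqPair (codes n k i.castSucc) (approx k i)) ^ 2 = 0 := by
    refine le_antisymm (Int.lt_add_one_iff.1 ?_) h2
    rw [zero_add, ← Int.cast_lt (R := ℝ), Int.cast_one]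
    linarith
  rw [Finset.sum_eq_zero_iff_of_nonneg fun _ _ => sq_nonneg _] at e2
  have hch : codes n k (Fin.last _) = chain n (approx k) (a + m + 2) le_rfl := by
    refine eq_chain_of_forall (c := codes n k) rfl (fun i => ?_) (a + m + 2) le_rfl
    have := pow_eq_zero_iff two_ne_zero |>.1 (e2 i (Finset.mem_univ i))
    exact_mod_cast sub_eq_zero.1 this
  constructor
  · have := (hW _).2 ⟨_, e1⟩
    rwa [hch, iterate_sqLeft_chain_self, unchain_chain] at this
  · intro i
    have := Finset.single_le_sum
      (f := fun i => err (approx k) (Fin.append x fun j => z j ^ 2) i ^ 2)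
      (fun _ _ => sq_nonneg _) (Finset.mem_univ i)
    rw [← sq_lt_one_iff_abs_lt_one]
    linarith

/-- Good approximations make the penalty arbitrarily small. -/
theorem exists_penalty_lt {f : ℕ → Option (Code a m)}
    {q : MvPolynomial (Fin ν ⊕ Unit ⊕ Fin μ) ℤ} {par : Fin μ → ℕ}
    (hW : ∀ N, Good f (sqLeft^[a + m + 2] N) (unchain (a + m + 2) N) ↔
      ∃ y, evalParam q y N par = 0)
    (ho : OpenAt f n (Fin.append x fun j => z j ^ 2)) (b : Fin 2 → ℕ) {ε : ℝ} (hε : 0 < ε) :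
    ∃ k : Unknown (a + m + 2) ν → ℕ, (∀ i, k (.inl i) = b i) ∧
      aeval (assign x z n k) (penalty q par) < ε := by
  have hM : (0 : ℝ) < (a + m : ℕ) + 1 := by positivity
  -- The bound 1 gives `err ^ 2 ≤ |err|`. Dividing by one more than the number of coordinates keeps
  -- the sum strictly below `ε`, even when there are none.
  obtain ⟨g, hg, herr⟩ := ho.exists_good (lt_min one_pos (div_pos hε hM))
  have hN := hW (chain n g _ le_rfl)
  rw [iterate_sqLeft_chain_self, unchain_chain] at hN
  obtain ⟨y, hy⟩ := hN.1 hg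
  let k : Unknown (a + m + 2) ν → ℕ :=
    Sum.elim b (Sum.elim (fun i => chain n g (i + 1) i.2) (Sum.elim g y))
  have hc : ∀ i : Fin (a + m + 2 + 1), codes n k i = chain n g i (Nat.le_of_lt_succ i.2) :=
    fun i => by refine Fin.cases ?_ (fun i => ?_) i <;> rfl
  refine ⟨k, fun _ => rfl, ?_⟩
  rw [aeval_penalty]
  have e1 : evalParam q (fun i => k (.inr (.inr (.inr i)))) (codes n k (Fin.last _)) par = 0 := by
    rw [hc]; exact hy
  have e2 : ∀ i : Fin (a + m + 2), ((codes n k i.succ : ℤ) -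
      sqPair (codes n k i.castSucc) (approx k i)) ^ 2 = 0 := fun i => by
    rw [hc, hc, pow_eq_zero_iff two_ne_zero, sub_eq_zero]
    rfl
  rw [e1, Finset.sum_eq_zero fun i _ => e2 i, Int.cast_zero, add_zero, zero_add]
  have hle : ∀ i, err (approx k) (Fin.append x fun j => z j ^ 2) i ^ 2 ≤
      ε / ((a + m : ℕ) + 1) := fun i => by
    have h1 := (herr i).trans_le (min_le_left _ _)
    have h2 := (herr i).trans_le (min_le_right _ _)
    change err g _ i ^ 2 ≤ _
    rw [← sq_abs]
    nlinarith [abs_nonneg (err g (Fin.append x fun j => z j ^ 2) i)]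
  refine (Finset.sum_le_sum fun i _ => hle i).trans_lt ?_
  rw [Finset.sum_const, Finset.card_univ, Fintype.card_fin, nsmul_eq_mul, ← mul_div_assoc,
    div_lt_iff₀ hM]
  nlinarith

end Polynomials

/-! ### Suprema and infima over the natural unknowns -/

theorem iSup_coe_eq_truth {ι : Type*} {F : ι → ℝ} {Q : Prop} (h1 : ∀ i, F i ≤ 1)
    (hQ : Q → ∀ ε > 0, ∃ i, 1 - ε < F i) (hnQ : ¬ Q → ∀ i, F i ≤ 0) (h0 : ∃ i, 0 ≤ F i) :
    ⨆ i, (F i : EReal) = truth Q := by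
  by_cases h : Q
  · rw [truth_of h]
    refine le_antisymm (iSup_le fun i => by exact_mod_cast h1 i) (le_of_forall_lt fun c hc => ?_)
    obtain ⟨r, hcr, hr⟩ := EReal.lt_iff_exists_real_btwn.1 hc
    have hr1 : r < 1 := by exact_mod_cast hr
    obtain ⟨i, hi⟩ := hQ h (1 - r) (sub_pos.2 hr1)
    rw [sub_sub_cancel] at hi
    exact lt_iSup_iff.2 ⟨i, hcr.trans (by exact_mod_cast hi)⟩
  · rw [truth_of_not h]
    obtain ⟨i, hi⟩ := h0
    exact le_antisymm (iSup_le fun i => by exact_mod_cast hnQ h i)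
      (le_iSup_of_le i (by exact_mod_cast hi))

theorem iInf_one_sub_coe_eq_truth {ι : Type*} {F : ι → ℝ} {Q : Prop} (h1 : ∀ i, F i ≤ 1)
    (hQ : Q → ∀ ε > 0, ∃ i, 1 - ε < F i) (hnQ : ¬ Q → ∀ i, F i ≤ 0) (h0 : ∃ i, 0 ≤ F i) :
    ⨅ i, ((1 - F i : ℝ) : EReal) = truth (¬ Q) := by
  by_cases h : Q
  · rw [truth_of_not (not_not.2 h)]
    refine le_antisymm (le_of_forall_gt fun c hc => ?_)
      (le_iInf fun i => by exact_mod_cast sub_nonneg.2 (h1 i))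
    obtain ⟨r, hr, hcr⟩ := EReal.lt_iff_exists_real_btwn.1 hc
    have hr1 : 0 < r := by exact_mod_cast hr
    obtain ⟨i, hi⟩ := hQ h r hr1
    exact iInf_lt_iff.2 ⟨i, lt_trans (by exact_mod_cast sub_lt_comm.1 hi) hcr⟩
  · rw [truth_of h]
    obtain ⟨i, hi⟩ := h0
    refine le_antisymm (iInf_le_of_le i ?_) (le_iInf fun i => ?_)
    · exact_mod_cast sub_le_self 1 hi
    · exact_mod_cast le_sub_self_iff 1 |>.2 (hnQ h i)

section Values

variable {a m ν μ r n : ℕ} {x : Fin a → ℝ} {z : Fin m → ℝ} {f : ℕ → Option (Code a m)}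
  {q : MvPolynomial (Fin ν ⊕ Unit ⊕ Fin μ) ℤ} {par : Fin μ → ℕ}

theorem aeval_mainPoly (k : Unknown (a + m + 2) ν → ℕ) :
    aeval (assign x z n k) (mainPoly q par r) =
      (k (.inl 0) : ℝ) * (2 - k (.inl 0) - aeval (assign x z n k) (penalty q par)) -
        k (.inl 0) * (k (.inl 1) : ℝ) ^ r := by
  simp only [mainPoly, map_sub, map_mul, map_pow, aeval_X, map_ofNat]
  rfl

theorem penalty_nonneg (hnn : ∀ y N, 0 ≤ evalParam q y N par) (k : Unknown (a + m + 2) ν → ℕ) :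
    0 ≤ aeval (assign x z n k) (penalty q par) := by
  rw [aeval_penalty]
  refine add_nonneg (add_nonneg ?_ ?_) (Finset.sum_nonneg fun _ _ => sq_nonneg _)
  · exact_mod_cast hnn _ _
  · exact Int.cast_nonneg (Finset.sum_nonneg fun _ _ => sq_nonneg _)

/-- Dropping the nonnegative penalty and padding terms leaves `u * (2 - u) = 1 - (u - 1) ^ 2`. -/
theorem mainPoly_le_one (hnn : ∀ y N, 0 ≤ evalParam q y N par)
    (k : Unknown (a + m + 2) ν → ℕ) : aeval (assign x z n k) (mainPoly q par r) ≤ 1 := by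
  rw [aeval_mainPoly]
  have h1 := mul_nonneg (Nat.cast_nonneg (α := ℝ) (k (.inl 0)))
    (penalty_nonneg (x := x) (z := z) (n := n) hnn k)
  have h2 : (0 : ℝ) ≤ k (.inl 0) * (k (.inl 1) : ℝ) ^ r := by positivity
  nlinarith [sq_nonneg ((k (.inl 0) : ℝ) - 1)]

/-- Integrality of the switch is essential: either `u = 0`, or `u ≥ 1` and the bracket is at most 0.
-/
theorem mainPoly_nonpos {k : Unknown (a + m + 2) ν → ℕ}
    (hk : 1 ≤ aeval (assign x z n k) (penalty q par)) :
    aeval (assign x z n k) (mainPoly q par r) ≤ 0 := by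
  rw [aeval_mainPoly]
  have h2 : (0 : ℝ) ≤ k (.inl 0) * (k (.inl 1) : ℝ) ^ r := by positivity
  have h3 : (k (.inl 0) : ℝ) * (2 - k (.inl 0) - aeval (assign x z n k) (penalty q par)) ≤ 0 := by
    rcases Nat.eq_zero_or_pos (k (.inl 0)) with h0 | h0
    · simp [h0]
    · have h1 : (1 : ℝ) ≤ k (.inl 0) := by exact_mod_cast h0
      exact mul_nonpos_of_nonneg_of_nonpos (by linarith) (by linarith)
  linarith

theorem one_sub_lt_mainPoly (hr : r ≠ 0)
    (hW : ∀ N, Good f (sqLeft^[a + m + 2] N) (unchain (a + m + 2) N) ↔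
      ∃ y, evalParam q y N par = 0)
    (ho : OpenAt f n (Fin.append x fun j => z j ^ 2)) {ε : ℝ} (hε : 0 < ε) :
    ∃ k, 1 - ε < aeval (assign x z n k) (mainPoly q par r) := by
  -- With switch 1 and padding 0 the value is exactly `1 - penalty`.
  obtain ⟨k, hk, hlt⟩ := exists_penalty_lt (x := x) (z := z) hW ho ![1, 0] hε
  refine ⟨k, ?_⟩
  rw [aeval_mainPoly, hk 0, hk 1]
  simp only [Matrix.cons_val_zero, Matrix.cons_val_one, Nat.cast_one, Nat.cast_zero,
    zero_pow hr]
  linarith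

theorem iSup_mainPoly (hr : r ≠ 0) (hnn : ∀ y N, 0 ≤ evalParam q y N par)
    (hW : ∀ N, Good f (sqLeft^[a + m + 2] N) (unchain (a + m + 2) N) ↔
      ∃ y, evalParam q y N par = 0) :
    ⨆ k, ((aeval (assign x z n k) (mainPoly q par r) : ℝ) : EReal) =
        truth (OpenAt f n (Fin.append x fun j => z j ^ 2)) ∧
      ⨅ k, ((1 - aeval (assign x z n k) (mainPoly q par r) : ℝ) : EReal) =
        truth (¬ OpenAt f n (Fin.append x fun j => z j ^ 2)) := by
  have h0 : ∃ k, 0 ≤ aeval (assign x z n k) (mainPoly q par r) :=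
    ⟨0, by rw [aeval_mainPoly]; simp⟩
  have hnQ : ¬ OpenAt f n (Fin.append x fun j => z j ^ 2) →
      ∀ k, aeval (assign x z n k) (mainPoly q par r) ≤ 0 := fun hn k => by
    refine mainPoly_nonpos (not_lt.1 fun hk => hn ?_)
    obtain ⟨hg, he⟩ := good_of_penalty_lt_one hnn hW hk
    exact hg.openAt he
  exact ⟨iSup_coe_eq_truth (mainPoly_le_one hnn)
      (fun ho _ hε => one_sub_lt_mainPoly hr hW ho hε) hnQ h0,
    iInf_one_sub_coe_eq_truth (mainPoly_le_one hnn)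
      (fun ho _ hε => one_sub_lt_mainPoly hr hW ho hε) hnQ h0⟩

end Values

/-! ### Reindexing the unknowns and conclusion -/

theorem evalPoly_rename {a m L ν K : ℕ} (e : Unknown L ν ≃ Fin K) (p : MvPolynomial (Var a m L ν) ℤ)
    (x : Fin a → ℝ) (z : Fin m → ℝ) (n : ℕ) (k : Fin K → ℕ) :
    evalPoly (rename (Equiv.sumCongr (.refl _) (Equiv.sumCongr (.refl _)
      (Equiv.sumCongr (.refl _) e))) p) x z n k =
      ((aeval (assign x z n (k ∘ e)) p : ℝ) : EReal) := by
  rw [evalPoly, aeval_rename]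
  congr 3
  funext i
  rcases i with i | i | i | i <;> rfl

theorem totalDegree_one_sub {σ : Type*} {p : MvPolynomial σ ℤ} (hp : 0 < p.totalDegree) :
    (1 - p).totalDegree = p.totalDegree := by
  rw [sub_eq_neg_add, totalDegree_add_eq_left_of_totalDegree_lt, totalDegree_neg]
  rwa [totalDegree_one, totalDegree_neg]

end LightfaceProjective

open LightfaceProjective
theorem mainTheorem5 (ν δ μ : ℕ) (q : MvPolynomial (Fin ν ⊕ Unit ⊕ Fin μ) ℤ)
    (hq : PositivelyUniversal q) (hδ : degreeUnknowns q ≤ δ)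
    (a m : ℕ) (hm : 1 ≤ m) (X : Set (Fin a → ℝ)) (hX : IsLightfaceSigma m X) :
    ∃ p : MvPolynomial (Fin a ⊕ Fin m ⊕ Unit ⊕ Fin (6 + ν + 2 * a + 2 * m)) ℤ,
      p.totalDegree = max (3 + δ) 7 ∧
      (Odd m → ∀ x : Fin a → ℝ,
        altExtr true m (fun z => ⨅ n : ℕ, ⨆ k : Fin (6 + ν + 2 * a + 2 * m) → ℕ,
          evalPoly p x z n k) = X.indicator (fun _ => (1 : EReal)) x) ∧
      (Even m → ∀ x : Fin a → ℝ,
        altExtr true m (fun z => ⨆ n : ℕ, ⨅ k : Fin (6 + ν + 2 * a + 2 * m) → ℕ,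
          evalPoly p x z n k) = X.indicator (fun _ => (1 : EReal)) x) := by
  obtain ⟨U, ⟨W, hW, hU⟩, hXU⟩ := hX.exists_altEx
  obtain ⟨f, hf, hfW⟩ := exists_primrec_enumeration hW
  obtain ⟨par, hnn, hpar⟩ := hq _ (rePred_good hf)
  -- The padding exponent is one less than the required total degree.
  have hr : max (2 + δ) 6 ≠ 0 := by omega
  have hdeg := totalDegree_mainPoly (a := a) (m := m) (par := par) (le_max_right (2 + δ) 6)
    (hδ.trans ((Nat.le_add_left δ 2).trans (le_max_left (2 + δ) 6)))
  have hval := fun (x : Fin a → ℝ) (z : Fin m → ℝ) (n : ℕ) =>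
    iSup_mainPoly (x := x) (z := z) (n := n) hr hnn hpar
  have hmat := fun (x : Fin a → ℝ) (z : Fin m → ℝ) =>
    notMem_iff_forall_openAt hU hfW (x := x) (w := fun j => z j ^ 2) fun _ => sq_nonneg _
  have hind : ∀ x, X.indicator (fun _ => (1 : EReal)) x =
      truth (AltEx m fun z : Fin m → ℝ => ((x, fun j => digits (z j ^ 2)) : Space a m) ∈ U) := by
    intro x
    rw [altEx_comp_surjective surjective_digits_sq (fun w => ((x, w) : Space a m) ∈ U), ← hXU]
    by_cases h : x ∈ X <;> simp [h, truth]
  have hcard : Fintype.card (Unknown (a + m + 2) ν) = 6 + ν + 2 * a + 2 * m := by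
    simp only [Fintype.card_sum, Fintype.card_fin]
    ring
  let e := Fintype.equivFinOfCardEq hcard
  have he : Function.Surjective fun k : Fin (6 + ν + 2 * a + 2 * m) → ℕ => k ∘ e :=
    fun k => ⟨k ∘ e.symm, by funext i; simp⟩
  let E : Var a m (a + m + 2) ν ≃ _ := Equiv.sumCongr (.refl (Fin a)) (Equiv.sumCongr
    (.refl (Fin m)) (Equiv.sumCongr (.refl Unit) e))
  have hE : ∀ p : MvPolynomial (Var a m (a + m + 2) ν) ℤ,
      (MvPolynomial.rename E p).totalDegree = p.totalDegree :=
    fun p => MvPolynomial.totalDegree_renameEquiv E p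
  -- For even `m` the innermost matrix is membership in `U`, a union over `n` of complements of the
  -- open sets, so `1 - mainPoly` is used. For odd `m` it is the intersection itself.
  rcases Nat.even_or_odd m with hpar' | hpar'
  · refine ⟨MvPolynomial.rename E (1 - mainPoly q par (max (2 + δ) 6)), ?_,
      fun h => absurd h (Nat.not_odd_iff_even.2 hpar'), fun _ x => ?_⟩
    · rw [hE, totalDegree_one_sub (by omega), hdeg]
      omega
    · rw [hind, ← (altExtr_truth m _).1]
      congr 1
      funext z
      simp only [iff_false_left (Nat.not_odd_iff_even.2 hpar'), hmat]
      push Not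
      rw [← iSup_truth]
      refine iSup_congr fun n => ?_
      rw [← (hval x z n).2, ← he.iInf_comp]
      refine iInf_congr fun k => ?_
      rw [evalPoly_rename, map_sub, map_one]
  · refine ⟨MvPolynomial.rename E (mainPoly q par (max (2 + δ) 6)), ?_, fun _ x => ?_,
      fun h => absurd hpar' (Nat.not_odd_iff_even.2 h)⟩
    · rw [hE, hdeg]
      omega
    · rw [hind, ← (altExtr_truth m _).1]
      congr 1
      funext z
      simp only [iff_true_left hpar', hmat]
      rw [← iInf_truth]
      refine iInf_congr fun n => ?_
      rw [← (hval x z n).1, ← he.iSup_comp]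
      exact iSup_congr fun k => evalPoly_rename _ _ _ _ _ _
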